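/- **Setting.** Presburger arithmetic formulas are the first-order formulas over $\mathbb{Z}$ whose terms are built from variables, the constants $0,1$, unary $-$ and binary $+$; whose atomic formulas are $t_1\bowtie t_2$ with $\bowtie\in\{=,\neq,<,\le,>,\ge\}$ and $d\mid t$ with an integer $d\ge 2$; and which are closed under $\neg,\wedge,\vee,\rightarrow,\leftrightarrow$ and quantifiers $Qx$, $Q\in\{\exists,\forall\}$. A formula $\varphi(x_1,\dots,x_r)$ (free variables among $x_1,\dots,x_r$, $r\ge 0$) defines $[\![\varphi]\!]=\{a\in\mathbb{Z}^r : \mathbb{Z}\models\varphi[a]\}$. The length of $\varphi$ is its number of letters: each occurrence of a variable, constant $0$ or $1$, operation, relation symbol, connective or quantifier counts $1$, parentheses are not counted, and $d\mid t$ has the length of $t$ plus $d+1$ (integers are thus written in unary). Let $\overline Q$ be the dual of the quantifier $Q$. Put $\mathrm{qa}_Q=\mathrm{qbl}_Q=0$ on atomic formulas, $$\mathrm{qa}_Q(\neg\psi)=\mathrm{qa}_{\overline Q}(\psi),\quad \mathrm{qa}_Q(\psi_1\oplus\psi_2)=\max\{\mathrm{qa}_Q(\psi_1),\mathrm{qa}_Q(\psi_2)\}\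 (\oplus\in\{\wedge,\vee\}),\quad \mathrm{qa}_Q(Qx\psi)=\max\{1,\mathrm{qa}_Q(\psi)\},\quad \mathrm{qa}_Q(\overline Qx\psi)=1+\mathrm{qa}_{\overline Q}(\psi),$$ $$\mathrm{qbl}_Q(\neg\psi)=\mathrm{qbl}_{\overline Q}(\psi),\quad \mathrm{qbl}_Q(\psi_1\oplus\psi_2)=\mathrm{qbl}_Q(\psi_1)+\mathrm{qbl}_Q(\psi_2),\quad \mathrm{qbl}_Q(Qx\psi)=1+\mathrm{qbl}_Q(\psi),\quad \mathrm{qbl}_Q(\overline Qx\psi)=0,$$ where both treat $\psi_1\rightarrow\psi_2$ as $\neg\psi_1\vee\psi_2$ and $\psi_1\leftrightarrow\psi_2$ as $(\psi_1\rightarrow\psi_2)\wedge(\psi_2\rightarrow\psi_1)$. The number of quantifier alternations is $\mathrm{qa}(\varphi)=\min\{\mathrm{qa}_\exists(\varphi),\mathrm{qa}_\forall(\varphi)\}$, and the quantifier block length $\mathrm{qbl}(\varphi)$ is the maximum of $\mathrm{qbl}_Q(\psi)$ over $Q\in\{\exists,\forall\}$ and all subformulas $\psi$ of $\varphi$. Fix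 a base $\varrho\ge 2$ and let $\Sigma=\{0,\dots,\varrho-1\}$. A word $b_n b_{n-1}\dots b_0\in\Sigma^+$ encodes the integer $\sum_{i<n}\varrho^i b_i$ if $b_n=0$ and $\sum_{i<n}\varrho^i b_i-\varrho^n$ if $b_n\neq 0$; a word over $\Sigma^r$ of positive length encodes a tuple in $\mathbb{Z}^r$ track by track. A (complete, finite) deterministic word automaton over $\Sigma^r$ represents $U\subseteq\mathbb{Z}^r$ if it accepts exactly the nonempty words that encode an element of $U$. It is minimal if every deterministic word automaton with the same language has more states or is isomorphic to it. **Theorem.** For every base $\varrho\ge2$ and every Presburger arithmetic formula $\varphi(x_1,\dots,x_r)$ of length $n$ there is a minimal deterministic word automaton representing $[\![\varphi]\!]$, and every such automaton has at most $$2^{\,n^{(\mathrm{qbl}(\varphi)+1)^{\mathrm{qa}(\varphi)+4}}}$$ states. In particular, if $\varphi$ is in prenex normal form, it has at most $2^{2^{2^{\,n\lceil\log_2 n\rceil}}}$ states. -/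

import Mathlib

namespace PA

/-! ### Syntax and semantics of Presburger arithmetic over the extended language

Formulas are well scoped: `Formula r` consists of the formulas `φ(x₁, …, x_r)` whose free variables
are among `x₁, …, x_r` (indexed by `Fin r`); a quantifier binds the last of `r + 1` variables. -/

inductive Term (r : ℕ) : Type
  | var (i : Fin r) : Term r
  | zero : Term r
  | one : Term r
  | neg (t : Term r) : Term r
  | add (s t : Term r) : Term r

def Term.eval {r : ℕ} (a : Fin r → ℤ) : Term r → ℤ
  | .var i => a i
  | .zero => 0
  | .one => 1
  | .neg t => -(t.eval a)
  | .add s t => s.eval a + t.eval a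

inductive Rel : Type
  | eq | ne | lt | le | gt | ge

def Rel.holds : Rel → ℤ → ℤ → Prop
  | .eq, x, y => x = y
  | .ne, x, y => x ≠ y
  | .lt, x, y => x < y
  | .le, x, y => x ≤ y
  | .gt, x, y => x > y
  | .ge, x, y => x ≥ y

inductive Quant : Type
  | ex | all
  deriving DecidableEq

def Quant.dual : Quant → Quant
  | .ex => .all
  | .all => .ex

inductive Formula : ℕ → Type
  | rel {r : ℕ} (R : Rel) (s t : Term r) : Formula r
  | dvd {r : ℕ} (d : ℕ) (hd : 2 ≤ d) (t : Term r) : Formula r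
  | not {r : ℕ} (φ : Formula r) : Formula r
  | and {r : ℕ} (φ ψ : Formula r) : Formula r
  | or {r : ℕ} (φ ψ : Formula r) : Formula r
  | imp {r : ℕ} (φ ψ : Formula r) : Formula r
  | iff {r : ℕ} (φ ψ : Formula r) : Formula r
  | quant {r : ℕ} (Q : Quant) (φ : Formula (r + 1)) : Formula r

namespace Formula

/-- `φ.Sat a` means that `φ[a₁, …, a_r]` is true in the integers. -/
def Sat : {r : ℕ} → Formula r → (Fin r → ℤ) → Prop
  | _, rel R s t, a => R.holds (s.eval a) (t.eval a)
  | _, dvd d _ t, a => (d : ℤ) ∣ t.eval a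
  | _, not φ, a => ¬ φ.Sat a
  | _, and φ ψ, a => φ.Sat a ∧ ψ.Sat a
  | _, or φ ψ, a => φ.Sat a ∨ ψ.Sat a
  | _, imp φ ψ, a => φ.Sat a → ψ.Sat a
  | _, iff φ ψ, a => φ.Sat a ↔ ψ.Sat a
  | _, quant .ex φ, a => ∃ z : ℤ, φ.Sat (Fin.snoc (α := fun _ => ℤ) a z)
  | _, quant .all φ, a => ∀ z : ℤ, φ.Sat (Fin.snoc (α := fun _ => ℤ) a z)

/-- The set of integer tuples defined by `φ`. -/
def solutions {r : ℕ} (φ : Formula r) : Set (Fin r → ℤ) := {a | φ.Sat a}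

end Formula

/-! ### Length: the number of letters

Every variable, constant `0` or `1`, operation, relation symbol, connective and quantifier is one
letter; parentheses are not counted (counting them can only increase the length). Integers are thus
written in unary, and `d ∣ t` has the length of `t` plus `d + 1`. -/

def Term.length {r : ℕ} : Term r → ℕ
  | .var _ => 1
  | .zero => 1
  | .one => 1
  | .neg t => 1 + t.length
  | .add s t => s.length + 1 + t.length

namespace Formula

def length : {r : ℕ} → Formula r → ℕ
  | _, rel _ s t => s.length + 1 + t.length
  | _, dvd d _ t => t.length + (d + 1)
  | _, not φ => 1 + φ.length
  | _, and φ ψ => φ.length + 1 + ψ.length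
  | _, or φ ψ => φ.length + 1 + ψ.length
  | _, imp φ ψ => φ.length + 1 + ψ.length
  | _, iff φ ψ => φ.length + 1 + ψ.length
  | _, quant _ φ => 2 + φ.length

/-! ### Quantifier alternations -/

/-- The clauses for `→` and `↔` are those of `¬φ ∨ ψ` and `(φ → ψ) ∧ (ψ → φ)`,
see `qaQ_imp` and `qaQ_iff`. -/
def qaQ : {r : ℕ} → Quant → Formula r → ℕ
  | _, _, rel _ _ _ => 0
  | _, _, dvd _ _ _ => 0
  | _, Q, not φ => φ.qaQ Q.dual
  | _, Q, and φ ψ => max (φ.qaQ Q) (ψ.qaQ Q)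
  | _, Q, or φ ψ => max (φ.qaQ Q) (ψ.qaQ Q)
  | _, Q, imp φ ψ => max (φ.qaQ Q.dual) (ψ.qaQ Q)
  | _, Q, iff φ ψ => max (max (φ.qaQ Q.dual) (ψ.qaQ Q)) (max (ψ.qaQ Q.dual) (φ.qaQ Q))
  | _, Q, quant Q' φ => if Q' = Q then max 1 (φ.qaQ Q) else 1 + φ.qaQ Q.dual

theorem qaQ_imp {r : ℕ} (Q : Quant) (φ ψ : Formula r) :
    (imp φ ψ).qaQ Q = (or (not φ) ψ).qaQ Q := by simp only [qaQ]

theorem qaQ_iff {r : ℕ} (Q : Quant) (φ ψ : Formula r) :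
    (iff φ ψ).qaQ Q = (and (imp φ ψ) (imp ψ φ)).qaQ Q := by simp only [qaQ]

/-- The number of quantifier alternations. -/
def qa {r : ℕ} (φ : Formula r) : ℕ := min (φ.qaQ .ex) (φ.qaQ .all)

/-! ### Quantifier block length -/

/-- The clauses for `→` and `↔` are those of `¬φ ∨ ψ` and `(φ → ψ) ∧ (ψ → φ)`,
see `qblQ_imp` and `qblQ_iff`. -/
def qblQ : {r : ℕ} → Quant → Formula r → ℕ
  | _, _, rel _ _ _ => 0
  | _, _, dvd _ _ _ => 0
  | _, Q, not φ => φ.qblQ Q.dual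
  | _, Q, and φ ψ => φ.qblQ Q + ψ.qblQ Q
  | _, Q, or φ ψ => φ.qblQ Q + ψ.qblQ Q
  | _, Q, imp φ ψ => φ.qblQ Q.dual + ψ.qblQ Q
  | _, Q, iff φ ψ => (φ.qblQ Q.dual + ψ.qblQ Q) + (ψ.qblQ Q.dual + φ.qblQ Q)
  | _, Q, quant Q' φ => if Q' = Q then 1 + φ.qblQ Q else 0

theorem qblQ_imp {r : ℕ} (Q : Quant) (φ ψ : Formula r) :
    (imp φ ψ).qblQ Q = (or (not φ) ψ).qblQ Q := by simp only [qblQ]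

theorem qblQ_iff {r : ℕ} (Q : Quant) (φ ψ : Formula r) :
    (iff φ ψ).qblQ Q = (and (imp φ ψ) (imp ψ φ)).qblQ Q := by simp only [qblQ]

/-- All subformulas, each with its number of variables in scope. -/
def subformulas : {r : ℕ} → Formula r → List (Σ k : ℕ, Formula k)
  | r, rel R s t => [⟨r, rel R s t⟩]
  | r, dvd d hd t => [⟨r, dvd d hd t⟩]
  | r, not φ => ⟨r, not φ⟩ :: φ.subformulas
  | r, and φ ψ => ⟨r, and φ ψ⟩ :: (φ.subformulas ++ ψ.subformulas)
  | r, or φ ψ => ⟨r, or φ ψ⟩ :: (φ.subformulas ++ ψ.subformulas)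
  | r, imp φ ψ => ⟨r, imp φ ψ⟩ :: (φ.subformulas ++ ψ.subformulas)
  | r, iff φ ψ => ⟨r, iff φ ψ⟩ :: (φ.subformulas ++ ψ.subformulas)
  | r, quant Q φ => ⟨r, quant Q φ⟩ :: φ.subformulas

/-- The quantifier block length: the maximum of `qblQ Q ψ` over the quantifiers `Q` and the
subformulas `ψ` of `φ`. -/
def qbl {r : ℕ} (φ : Formula r) : ℕ :=
  (φ.subformulas.map fun ψ => max (ψ.2.qblQ .ex) (ψ.2.qblQ .all)).foldr max 0

/-! ### Prenex normal form -/

def IsQF : {r : ℕ} → Formula r → Prop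
  | _, rel _ _ _ => True
  | _, dvd _ _ _ => True
  | _, not φ => φ.IsQF
  | _, and φ ψ => φ.IsQF ∧ ψ.IsQF
  | _, or φ ψ => φ.IsQF ∧ ψ.IsQF
  | _, imp φ ψ => φ.IsQF ∧ ψ.IsQF
  | _, iff φ ψ => φ.IsQF ∧ ψ.IsQF
  | _, quant _ _ => False

/-- `φ` is `Q₁x₁ … Q_mx_m ψ₀` with `ψ₀` quantifier-free. -/
inductive IsPrenex : {r : ℕ} → Formula r → Prop
  | of_isQF {r : ℕ} {φ : Formula r} (h : φ.IsQF) : IsPrenex φ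
  | quant {r : ℕ} (Q : Quant) {φ : Formula (r + 1)} (h : IsPrenex φ) : IsPrenex (quant Q φ)

end Formula

/-! ### Encoding of integer tuples, most significant digit first, in `ϱ`'s complement -/

/-- The natural number with base-`ϱ` digits `w`, most significant digit first. -/
def natVal {ϱ : ℕ} (w : List (Fin ϱ)) : ℕ := Nat.ofDigits ϱ (w.map Fin.val).reverse

/-- The integer encoded by a nonempty word, whose first letter is the sign letter (the empty word
encodes no integer; its value here is never used). -/
def intVal {ϱ : ℕ} : List (Fin ϱ) → ℤ
  | [] => 0
  | b :: u => (natVal u : ℤ) - if b.val = 0 then 0 else (ϱ : ℤ) ^ u.length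

/-- The tuple encoded by a word over the alphabet of `r`-tuples of digits, track by track. -/
def tupleVal {ϱ r : ℕ} (w : List (Fin r → Fin ϱ)) : Fin r → ℤ :=
  fun i => intVal (w.map fun b => b i)

/-- `L` represents `U`. -/
def Represents {ϱ r : ℕ} (L : Language (Fin r → Fin ϱ)) (U : Set (Fin r → ℤ)) : Prop :=
  ∀ w : List (Fin r → Fin ϱ), w ∈ L ↔ w ≠ [] ∧ tupleVal w ∈ U

/-- A deterministic automaton with finitely many states is minimal if every such automaton with
the same language has more states or is isomorphic to it. -/
def IsMinimal {α σ : Type} [Fintype σ] (A : DFA α σ) : Prop :=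
  ∀ (τ : Type) [Fintype τ] (B : DFA α τ), B.accepts = A.accepts →
    Fintype.card σ < Fintype.card τ ∨ ∃ e : σ ≃ τ, DFA.reindex e A = B

end PA

namespace PA

/-! ### Minimal automata -/

/-! An automaton reading the most significant digit first only has to remember a finite quotient of
the integer tuples that is compatible with `push`, i.e. a tracking map. Residues modulo D give one.
A linear form truncated at some K not below the sum of its absolute coefficients gives another: once
its value reaches K or -K, later digits cannot bring it back (`clamp_lin_push`). Hence a set
determined by s truncated forms and residues (`Tame`) has a small automaton (`Tame.recognizable`),
and it remains to bound the number of forms, their coefficients and the modulus for the set defined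
by the formula.

Quantifiers are eliminated on sets instead of formulas. A witness z can be moved by multiples of D,
changing no truncated value, until some form that involves z is small (`exists_near`). Fixing the
value of that form eliminates z from the other forms by cross-multiplication (`Tame.proj_branch`).
So a projection is a union of at most s tame sets, each still with at most s forms, and the bit size
is multiplied by 4 (`Tame.proj`). Within a quantifier block the union is kept as a union
(`TameUnion`), so that the number of forms per member does not grow. Only at an alternation, where a
complement is needed, are its members merged into one tame set (`TameUnion.tame`). A block length of
at most b thus raises the number of forms roughly to the power b + 1, which is the recursion of
`formBound` and `sizeBound`.

The induction `Formula.modeBound` follows every subformula and its negation, so that the quantifier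
being eliminated is always existential. Quantifier-free formulas need a sharper estimate and are
treated separately (`Formula.IsQF.recognizable`). -/

theorem IsMinimal.card_le {α σ τ : Type} [Fintype σ] [Fintype τ] {A : DFA α σ}
    (hA : IsMinimal A) (B : DFA α τ) (h : B.accepts = A.accepts) :
    Fintype.card σ ≤ Fintype.card τ := by
  rcases hA τ B h with h | ⟨e, -⟩
  · exact h.le
  · exact (Fintype.card_congr e).le

/-- Every left quotient is the language accepted from some state of B. If B has no more states than
there are quotients, counting forces `B.acceptsFrom` to be a bijection onto the quotients, and this
bijection is the isomorphism. -/
theorem isMinimal_reindex_toDFA {α τ : Type} [Fintype τ] {L : Language α}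
    (g : Set.range L.leftQuotient ≃ τ) : IsMinimal (DFA.reindex g L.toDFA) := by
  classical
  intro τ' _ B hB
  rw [DFA.accepts_reindex, Language.accepts_toDFA] at hB
  rw [or_iff_not_imp_left, not_lt]
  intro hcard
  have : Fintype (Set.range L.leftQuotient) := Fintype.ofEquiv τ g.symm
  have hq : ∀ w, L.leftQuotient w = B.acceptsFrom (B.eval w) := fun w => by
    rw [← hB, Language.leftQuotient_accepts_apply]
  have hsub : Set.range L.leftQuotient ⊆ Set.range B.acceptsFrom := by
    rintro _ ⟨w, rfl⟩
    exact ⟨B.eval w, (hq w).symm⟩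
  have hsub' : (Set.range L.leftQuotient).toFinset ⊆ Finset.univ.image B.acceptsFrom := by
    intro x hx
    obtain ⟨q, hq⟩ := hsub (Set.mem_toFinset.1 hx)
    exact Finset.mem_image.2 ⟨q, Finset.mem_univ _, hq⟩
  have h1 : (Set.range L.leftQuotient).toFinset.card = Fintype.card τ := by
    rw [Set.toFinset_card, Fintype.card_congr g]
  have himg : (Finset.univ.image B.acceptsFrom).card ≤ Fintype.card τ' := Finset.card_image_le
  have heq := Finset.eq_of_subset_of_card_le hsub' (by omega)
  have hinjOn : Set.InjOn B.acceptsFrom (Finset.univ : Finset τ') := by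
    apply Finset.injOn_of_card_image_eq
    rw [← heq, h1, Finset.card_univ]
    have := Finset.card_le_card hsub'
    omega
  have hinj : Function.Injective B.acceptsFrom := fun p q h => hinjOn (by simp) (by simp) h
  have hmem : ∀ q, B.acceptsFrom q ∈ Set.range L.leftQuotient := fun q => by
    rw [← Set.mem_toFinset, heq]
    exact Finset.mem_image_of_mem _ (Finset.mem_univ q)
  let f : τ' → Set.range L.leftQuotient := fun q => ⟨B.acceptsFrom q, hmem q⟩
  have hf : Function.Bijective f := by
    refine ⟨fun p q h => hinj (congrArg Subtype.val h), fun ⟨x, hx⟩ => ?_⟩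
    obtain ⟨q, rfl⟩ := hsub hx
    exact ⟨q, rfl⟩
  let e : τ' ≃ Set.range L.leftQuotient := Equiv.ofBijective f hf
  have hstep : ∀ q a, e (B.step q a) = L.toDFA.step (e q) a := by
    intro q a
    apply Subtype.ext
    ext x
    rfl
  have hstart : e B.start = L.toDFA.start := by
    apply Subtype.ext
    exact hB
  have haccept : ∀ q, e q ∈ L.toDFA.accept ↔ q ∈ B.accept := fun q => Iff.rfl
  refine ⟨g.symm.trans e.symm, ?_⟩
  obtain ⟨st, s0, ac⟩ := B
  simp only [DFA.reindex, Equiv.coe_fn_mk, DFA.mk.injEq]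
  refine ⟨?_, ?_, ?_⟩
  · funext q a
    simp [← hstep]
  · simp [← hstart]
  · ext q
    simp [← haccept]

theorem exists_isMinimal {α σ : Type} [Fintype σ] (B : DFA α σ) :
    ∃ (m : ℕ) (A : DFA α (Fin m)), A.accepts = B.accepts ∧ IsMinimal A := by
  have hreg : B.accepts.IsRegular := Language.isRegular_iff.2 ⟨σ, inferInstance, B, rfl⟩
  have : Fintype (Set.range B.accepts.leftQuotient) := hreg.finite_range_leftQuotient.fintype
  exact ⟨_, DFA.reindex (Fintype.equivFin _) B.accepts.toDFA, by simp,
    isMinimal_reindex_toDFA _⟩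

theorem Represents.accepts_eq {ϱ r : ℕ} {L L' : Language (Fin r → Fin ϱ)} {U : Set (Fin r → ℤ)}
    (h : Represents L U) (h' : Represents L' U) : L = L' := by
  ext w
  exact (h w).trans (h' w).symm

/-! ### Automata from congruences on integer tuples -/

/-- The tuple encoded by the word `w ++ [b]`, when `a` is encoded by the nonempty word `w`. -/
def push {ϱ r : ℕ} (a : Fin r → ℤ) (b : Fin r → Fin ϱ) : Fin r → ℤ :=
  fun i => ϱ * a i + ((b i).val : ℤ)

theorem natVal_append_singleton {ϱ : ℕ} (w : List (Fin ϱ)) (b : Fin ϱ) :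
    natVal (w ++ [b]) = ϱ * natVal w + b.val := by
  simp [natVal, Nat.ofDigits_cons, add_comm]

theorem intVal_append_singleton {ϱ : ℕ} {w : List (Fin ϱ)} (hw : w ≠ []) (b : Fin ϱ) :
    intVal (w ++ [b]) = ϱ * intVal w + b.val := by
  cases w with
  | nil => exact absurd rfl hw
  | cons c u =>
    simp only [List.cons_append, intVal, natVal_append_singleton, List.length_append,
      List.length_singleton]
    split_ifs <;> push_cast <;> ring

theorem tupleVal_append_singleton {ϱ r : ℕ} {w : List (Fin r → Fin ϱ)} (hw : w ≠ [])
    (b : Fin r → Fin ϱ) : tupleVal (w ++ [b]) = push (tupleVal w) b := by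
  funext i
  simp only [tupleVal, push, List.map_append, List.map_singleton]
  exact intVal_append_singleton (by simpa using hw) _

/-- The kernel of `h` is compatible with reading one more letter. -/
def IsTracking (ϱ : ℕ) {r : ℕ} {X : Type} (h : (Fin r → ℤ) → X) : Prop :=
  ∀ (b : Fin r → Fin ϱ) (a a' : Fin r → ℤ), h a = h a' → h (push a b) = h (push a' b)

/-- Membership in `U` is determined by a tracking map with at most `m` values. -/
def Recognizable (ϱ : ℕ) {r : ℕ} (m : ℕ) (U : Set (Fin r → ℤ)) : Prop :=
  ∃ (X : Type) (_ : Fintype X) (h : (Fin r → ℤ) → X), Fintype.card X ≤ m ∧ IsTracking ϱ h ∧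
    ∀ a a', h a = h a' → (a ∈ U ↔ a' ∈ U)

theorem Recognizable.exists_dfa {ϱ r m : ℕ} {U : Set (Fin r → ℤ)} (hU : Recognizable ϱ m U) :
    ∃ (τ : Type) (_ : Fintype τ) (B : DFA (Fin r → Fin ϱ) τ),
      Fintype.card τ ≤ m + 1 ∧ Represents B.accepts U := by
  classical
  obtain ⟨X, _, h, hcard, htrack, hsat⟩ := hU
  have : Nonempty (Fin r → ℤ) := ⟨0⟩
  let g : X → Fin r → ℤ := Function.invFun h
  have hg : ∀ a, h (g (h a)) = h a := fun a => Function.invFun_eq ⟨a, rfl⟩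
  -- The state `none` stands for the empty word: it encodes nothing, and the first letter is a sign
  -- letter, not read by `push`. In other states `g` picks a representative, whose choice is
  -- irrelevant by tracking.
  let B : DFA (Fin r → Fin ϱ) (Option X) :=
    { step := fun q b => match q with
        | none => some (h (tupleVal [b]))
        | some x => some (h (push (g x) b))
      start := none
      accept := {q | ∃ a ∈ U, q = some (h a)} }
  have heval : ∀ w, w ≠ [] → B.eval w = some (h (tupleVal w)) := by
    intro w
    induction w using List.reverseRecOn with
    | nil => exact fun hw => absurd rfl hw
    | append_singleton w b ih =>
      intro _
      rw [DFA.eval_append_singleton]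
      by_cases hw : w = []
      · subst hw
        rfl
      · rw [ih hw, tupleVal_append_singleton hw]
        exact congrArg some (htrack b _ _ (hg _))
  refine ⟨Option X, inferInstance, B, by simpa using hcard, fun w => ?_⟩
  rw [DFA.mem_accepts]
  by_cases hw : w = []
  · subst hw
    simp [B]
  · rw [heval w hw]
    constructor
    · rintro ⟨a, ha, h'⟩
      exact ⟨hw, (hsat _ _ (Option.some.inj h')).2 ha⟩
    · exact fun h' => ⟨_, h'.2, rfl⟩

theorem Recognizable.comb {ϱ r m₁ m₂ : ℕ} {U₁ U₂ U : Set (Fin r → ℤ)}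
    (h₁ : Recognizable ϱ m₁ U₁) (h₂ : Recognizable ϱ m₂ U₂)
    (hU : ∀ a a', (a ∈ U₁ ↔ a' ∈ U₁) → (a ∈ U₂ ↔ a' ∈ U₂) → (a ∈ U ↔ a' ∈ U)) :
    Recognizable ϱ (m₁ * m₂) U := by
  obtain ⟨X₁, _, f₁, hc₁, ht₁, hs₁⟩ := h₁
  obtain ⟨X₂, _, f₂, hc₂, ht₂, hs₂⟩ := h₂
  refine ⟨X₁ × X₂, inferInstance, fun a => (f₁ a, f₂ a), ?_, ?_, ?_⟩
  · rw [Fintype.card_prod]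
    exact Nat.mul_le_mul hc₁ hc₂
  · intro b a a' h
    rw [Prod.mk.injEq] at h ⊢
    exact ⟨ht₁ b _ _ h.1, ht₂ b _ _ h.2⟩
  · intro a a' h
    rw [Prod.mk.injEq] at h
    exact hU a a' (hs₁ _ _ h.1) (hs₂ _ _ h.2)

/-! ### Linear forms -/

/-- The value of the homogeneous linear form with coefficients `f`. -/
def lin {r : ℕ} (f a : Fin r → ℤ) : ℤ := ∑ i, f i * a i

/-- `v` truncated to the interval from `-K` to `K`. -/
def clamp (K v : ℤ) : ℤ := max (-K) (min K v)

theorem clamp_mem {K : ℤ} (hK : 0 ≤ K) (v : ℤ) : clamp K v ∈ Finset.Icc (-K) K := by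
  rw [Finset.mem_Icc, clamp]
  omega

theorem clamp_eq_iff {K v v' : ℤ} (hK : 0 < K) : clamp K v = clamp K v' ↔
    v = v' ∨ (K ≤ v ∧ K ≤ v') ∨ (v ≤ -K ∧ v' ≤ -K) := by
  unfold clamp
  omega

theorem lin_push {ϱ r : ℕ} (f a : Fin r → ℤ) (b : Fin r → Fin ϱ) :
    lin f (push a b) = ϱ * lin f a + lin f (fun i => ((b i).val : ℤ)) := by
  simp only [lin, push, Finset.mul_sum, ← Finset.sum_add_distrib]
  exact Finset.sum_congr rfl fun i _ => by ring

theorem abs_lin_digits_le {ϱ r : ℕ} {f : Fin r → ℤ} {K : ℤ} (hK : ∑ i, |f i| ≤ K)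
    (hϱ : 1 ≤ ϱ) (b : Fin r → Fin ϱ) :
    |lin f (fun i => ((b i).val : ℤ))| ≤ ((ϱ : ℤ) - 1) * K := by
  have hϱ' : (0 : ℤ) ≤ (ϱ : ℤ) - 1 := by omega
  refine (Finset.abs_sum_le_sum_abs _ _).trans
    (le_trans ?_ (mul_le_mul_of_nonneg_left hK hϱ'))
  rw [Finset.mul_sum]
  refine Finset.sum_le_sum fun i _ => ?_
  rw [abs_mul, mul_comm]
  refine mul_le_mul_of_nonneg_right ?_ (abs_nonneg _)
  rw [abs_of_nonneg (by positivity)]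
  have := (b i).isLt
  simp only
  omega

/-- The new digit contributes at most (ϱ - 1)K in absolute value, so a value v ≥ K becomes at least
ϱK - (ϱ - 1)K = K; symmetrically below -K. -/
theorem clamp_lin_push {ϱ r : ℕ} {f : Fin r → ℤ} {K : ℤ} (hK : ∑ i, |f i| ≤ K)
    (hK0 : 0 < K) (hϱ : 1 ≤ ϱ) (b : Fin r → Fin ϱ) {a a' : Fin r → ℤ}
    (h : clamp K (lin f a) = clamp K (lin f a')) :
    clamp K (lin f (push a b)) = clamp K (lin f (push a' b)) := by
  have hd := abs_le.1 (abs_lin_digits_le hK hϱ b)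
  have hϱ' : (0 : ℤ) ≤ ϱ := by positivity
  rw [clamp_eq_iff hK0] at h ⊢
  rw [lin_push, lin_push]
  rcases h with h | ⟨h, h'⟩ | ⟨h, h'⟩
  · exact Or.inl (by rw [h])
  · refine Or.inr (Or.inl ⟨?_, ?_⟩) <;> nlinarith
  · refine Or.inr (Or.inr ⟨?_, ?_⟩) <;> nlinarith

/-! ### Sets determined by truncated linear forms and residues -/

/-- `v` and `v'` are equal, both greater than `C`, or both less than `-C`. -/
def SameTrunc (C v v' : ℤ) : Prop := v = v' ∨ (C < v ∧ C < v') ∨ (v < -C ∧ v' < -C)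

theorem SameTrunc.mono {C C' v v' : ℤ} (h : SameTrunc C' v v') (hC : C ≤ C') :
    SameTrunc C v v' := by
  unfold SameTrunc at *
  omega

/-- Membership in `W` is determined by residues modulo some `D` and by the values, truncated at
`2 ^ l`, of at most `s` linear forms; `D` and the coefficients are at most `2 ^ l`. -/
def Tame {r : ℕ} (s l : ℕ) (W : Set (Fin r → ℤ)) : Prop :=
  ∃ (κ : Type) (_ : Fintype κ) (f : κ → Fin r → ℤ) (D : ℕ), Fintype.card κ ≤ s ∧ 0 < D ∧
    D ≤ 2 ^ l ∧ (∀ j i, |f j i| ≤ 2 ^ l) ∧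
    ∀ a a', (∀ i, (D : ℤ) ∣ a' i - a i) → (∀ j, SameTrunc (2 ^ l) (lin (f j) a) (lin (f j) a')) →
      (a ∈ W ↔ a' ∈ W)

theorem Tame.mono {r s l s' l' : ℕ} {W : Set (Fin r → ℤ)} (h : Tame s l W) (hs : s ≤ s')
    (hl : l ≤ l') : Tame s' l' W := by
  obtain ⟨κ, i, f, D, hc, hD, hDl, hf, hW⟩ := h
  have hp : (2 : ℤ) ^ l ≤ 2 ^ l' := pow_le_pow_right₀ (by norm_num) hl
  exact ⟨κ, i, f, D, hc.trans hs, hD, hDl.trans (Nat.pow_le_pow_right (by norm_num) hl),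
    fun j i => (hf j i).trans hp, fun a a' h1 h2 => hW a a' h1 fun j => (h2 j).mono hp⟩

theorem Tame.compl {r s l : ℕ} {W : Set (Fin r → ℤ)} (h : Tame s l W) : Tame s l Wᶜ := by
  obtain ⟨κ, i, f, D, hc, hD, hDl, hf, hW⟩ := h
  exact ⟨κ, i, f, D, hc, hD, hDl, hf, fun a a' h1 h2 => not_congr (hW a a' h1 h2)⟩

theorem Tame.comb {r s₁ l₁ s₂ l₂ : ℕ} {W₁ W₂ W : Set (Fin r → ℤ)}
    (h₁ : Tame s₁ l₁ W₁) (h₂ : Tame s₂ l₂ W₂)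
    (hW : ∀ a a', (a ∈ W₁ ↔ a' ∈ W₁) → (a ∈ W₂ ↔ a' ∈ W₂) → (a ∈ W ↔ a' ∈ W)) :
    Tame (s₁ + s₂) (l₁ + l₂) W := by
  obtain ⟨κ₁, _, f₁, D₁, hc₁, hD₁, hDl₁, hf₁, hW₁⟩ := h₁
  obtain ⟨κ₂, _, f₂, D₂, hc₂, hD₂, hDl₂, hf₂, hW₂⟩ := h₂
  have hp₁ : (2 : ℤ) ^ l₁ ≤ 2 ^ (l₁ + l₂) := pow_le_pow_right₀ (by norm_num) (by omega)
  have hp₂ : (2 : ℤ) ^ l₂ ≤ 2 ^ (l₁ + l₂) := pow_le_pow_right₀ (by norm_num) (by omega)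
  refine ⟨κ₁ ⊕ κ₂, inferInstance, Sum.elim f₁ f₂, D₁ * D₂, ?_, Nat.mul_pos hD₁ hD₂, ?_, ?_, ?_⟩
  · rw [Fintype.card_sum]
    exact Nat.add_le_add hc₁ hc₂
  · rw [pow_add]
    exact Nat.mul_le_mul hDl₁ hDl₂
  · rintro (j | j) i
    · exact (hf₁ j i).trans hp₁
    · exact (hf₂ j i).trans hp₂
  · intro a a' hD hT
    push_cast at hD
    refine hW a a' (hW₁ a a' (fun i => (Dvd.intro _ rfl).trans (hD i))
      fun j => (hT (Sum.inl j)).mono hp₁) (hW₂ a a' (fun i => (Dvd.intro_left _ rfl).trans (hD i))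
      fun j => (hT (Sum.inr j)).mono hp₂)

/-- `U` is the union of at most `N` sets that are `Tame s l`. -/
def TameUnion {r : ℕ} (N s l : ℕ) (U : Set (Fin r → ℤ)) : Prop :=
  ∃ (ι : Type) (_ : Fintype ι) (_ : Nonempty ι) (W : ι → Set (Fin r → ℤ)),
    Fintype.card ι ≤ N ∧ U = ⋃ i, W i ∧ ∀ i, Tame s l (W i)

theorem TameUnion.mono {r N s l N' s' l' : ℕ} {U : Set (Fin r → ℤ)} (h : TameUnion N s l U)
    (hN : N ≤ N') (hs : s ≤ s') (hl : l ≤ l') : TameUnion N' s' l' U := by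
  obtain ⟨ι, i, j, W, hc, hU, hW⟩ := h
  exact ⟨ι, i, j, W, hc.trans hN, hU, fun i => (hW i).mono hs hl⟩

theorem Tame.tameUnion {r s l : ℕ} {U : Set (Fin r → ℤ)} (h : Tame s l U) :
    TameUnion 1 s l U :=
  ⟨Unit, inferInstance, inferInstance, fun _ => U, by simp, (Set.iUnion_const U).symm,
    fun _ => h⟩

theorem TameUnion.tame_of_le_one {r N s l : ℕ} {U : Set (Fin r → ℤ)} (h : TameUnion N s l U)
    (hN : N ≤ 1) : Tame s l U := by
  obtain ⟨ι, _, ⟨i⟩, W, hc, rfl, hW⟩ := h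
  have := Fintype.card_le_one_iff_subsingleton.1 (hc.trans hN)
  have hU : ⋃ i, W i = W i := by
    ext a
    simp only [Set.mem_iUnion]
    exact ⟨fun ⟨j, hj⟩ => Subsingleton.elim j i ▸ hj, fun h => ⟨i, h⟩⟩
  exact hU ▸ hW i

theorem TameUnion.inter {r N₁ s₁ l₁ N₂ s₂ l₂ : ℕ} {U₁ U₂ : Set (Fin r → ℤ)}
    (h₁ : TameUnion N₁ s₁ l₁ U₁) (h₂ : TameUnion N₂ s₂ l₂ U₂) :
    TameUnion (N₁ * N₂) (s₁ + s₂) (l₁ + l₂) (U₁ ∩ U₂) := by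
  obtain ⟨ι₁, _, _, W₁, hc₁, rfl, hW₁⟩ := h₁
  obtain ⟨ι₂, _, _, W₂, hc₂, rfl, hW₂⟩ := h₂
  refine ⟨ι₁ × ι₂, inferInstance, inferInstance, fun p => W₁ p.1 ∩ W₂ p.2, ?_, ?_, fun p => ?_⟩
  · rw [Fintype.card_prod]
    exact Nat.mul_le_mul hc₁ hc₂
  · ext a
    simp only [Set.mem_inter_iff, Set.mem_iUnion, Prod.exists, exists_and_left, exists_and_right]
  · exact (hW₁ p.1).comb (hW₂ p.2) fun a a' h h' => and_congr h h'

theorem TameUnion.union {r N₁ s₁ l₁ N₂ s₂ l₂ : ℕ} {U₁ U₂ : Set (Fin r → ℤ)}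
    (h₁ : TameUnion N₁ s₁ l₁ U₁) (h₂ : TameUnion N₂ s₂ l₂ U₂) :
    TameUnion (N₁ * N₂) (s₁ + s₂) (l₁ + l₂) (U₁ ∪ U₂) := by
  obtain ⟨ι₁, _, _, W₁, hc₁, rfl, hW₁⟩ := h₁
  obtain ⟨ι₂, _, _, W₂, hc₂, rfl, hW₂⟩ := h₂
  refine ⟨ι₁ × ι₂, inferInstance, inferInstance, fun p => W₁ p.1 ∪ W₂ p.2, ?_, ?_, fun p => ?_⟩
  · rw [Fintype.card_prod]
    exact Nat.mul_le_mul hc₁ hc₂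
  · ext a
    simp only [Set.mem_union, Set.mem_iUnion, Prod.exists, exists_or, exists_const]
  · exact (hW₁ p.1).comb (hW₂ p.2) fun a a' h h' => or_congr h h'

/-- All forms are collected and the moduli multiplied. This is the expensive step, needed because
complements preserve `Tame` but not the shape of a union. -/
theorem TameUnion.tame {r N s l : ℕ} {U : Set (Fin r → ℤ)} (h : TameUnion N s l U) :
    Tame (N * s) (N * l) U := by
  obtain ⟨ι, _, _, W, hc, rfl, hW⟩ := h
  choose κ hκ f D hcard hD hDl hf hW using hW
  have hN : 1 ≤ N := Fintype.card_pos.trans_le hc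
  have hp : (2 : ℤ) ^ l ≤ 2 ^ (N * l) :=
    pow_le_pow_right₀ (by norm_num) (Nat.le_mul_of_pos_left l hN)
  refine ⟨Σ i, κ i, inferInstance, fun p => f p.1 p.2, ∏ i, D i, ?_,
    Finset.prod_pos fun i _ => hD i, ?_, fun p i => (hf p.1 p.2 i).trans hp, ?_⟩
  · rw [Fintype.card_sigma]
    refine (Finset.sum_le_card_nsmul _ _ s fun i _ => hcard i).trans ?_
    rw [smul_eq_mul]
    exact Nat.mul_le_mul_right s hc
  · refine (Finset.prod_le_pow_card _ _ _ fun i _ => hDl i).trans ?_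
    rw [← pow_mul, mul_comm]
    exact Nat.pow_le_pow_right (by norm_num) (Nat.mul_le_mul_right l hc)
  · intro a a' h1 h2
    simp only [Set.mem_iUnion]
    refine exists_congr fun i => hW i a a' (fun k => ?_) fun j => (h2 ⟨i, j⟩).mono hp
    exact (Int.natCast_dvd_natCast.2 (Finset.dvd_prod_of_mem D (Finset.mem_univ i))).trans (h1 k)

/-! ### Projections -/

/-- The projection of a set along the last coordinate. -/
def proj {r : ℕ} (W : Set (Fin (r + 1) → ℤ)) : Set (Fin r → ℤ) :=
  {a | ∃ z : ℤ, Fin.snoc (α := fun _ => ℤ) a z ∈ W}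

theorem lin_snoc {r : ℕ} (f : Fin (r + 1) → ℤ) (a : Fin r → ℤ) (z : ℤ) :
    lin f (Fin.snoc (α := fun _ => ℤ) a z) = lin (Fin.init f) a + f (Fin.last r) * z := by
  simp [lin, Fin.sum_univ_castSucc, Fin.init]

theorem lin_lincomb {r : ℕ} (c d : ℤ) (f g a : Fin r → ℤ) :
    lin (fun i => c * f i - d * g i) a = c * lin f a - d * lin g a := by
  simp only [lin, Finset.mul_sum, ← Finset.sum_sub_distrib]
  exact Finset.sum_congr rfl fun i _ => by ring

theorem dvd_lin_sub_lin {r : ℕ} {D : ℤ} (f : Fin r → ℤ) {a a' : Fin r → ℤ}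
    (h : ∀ i, D ∣ a' i - a i) : D ∣ lin f a' - lin f a := by
  simp only [lin, ← Finset.sum_sub_distrib, ← mul_sub]
  exact Finset.dvd_sum fun i _ => (h i).mul_left _

/-- This is the threshold arising in `Tame.proj_branch`: with x = 2 ^ l, the offset is at most x(x +
x²) and the rescaled old threshold at most x². Its bound x⁴ explains the factor 4 on l. -/
theorem two_pow_bound {l : ℕ} (hl : 1 ≤ l) :
    2 * (2 ^ l * 2 ^ l) + 2 ^ l * (2 ^ l * 2 ^ l) ≤ (2 : ℤ) ^ (4 * l) := by
  have h2 : (2 : ℤ) ≤ 2 ^ l := by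
    calc (2 : ℤ) = 2 ^ 1 := by norm_num
      _ ≤ 2 ^ l := pow_le_pow_right₀ (by norm_num) hl
  rw [mul_comm 4 l, pow_mul]
  generalize (2 : ℤ) ^ l = x at *
  have h3 : x * x * 2 ≤ x * x * x := by gcongr
  have h4 : x * x * x * 2 ≤ x * x * x * x := by gcongr
  nlinarith

theorem SameTrunc.trans {C u v w : ℤ} (hC : 0 ≤ C) (h : SameTrunc C u v) (h' : SameTrunc C v w) :
    SameTrunc C u w := by
  unfold SameTrunc at *
  omega

theorem SameTrunc.of_mul {α e w w' v v' C C' : ℤ} (hα : α ≠ 0) (h : SameTrunc C' w w')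
    (h₁ : α * v = w + e) (h₂ : α * v' = w' + e) (hC : |e| + |α| * C ≤ C') :
    SameTrunc C v v' := by
  have he := neg_abs_le e
  have he' := le_abs_self e
  rcases h with rfl | ⟨h, h'⟩ | ⟨h, h'⟩
  · exact Or.inl (mul_left_cancel₀ hα (h₁.trans h₂.symm))
  · have g₁ : |α| * C < α * v := by linarith
    have g₂ : |α| * C < α * v' := by linarith
    rcases lt_or_gt_of_ne hα with hneg | hpos
    · rw [abs_of_neg hneg] at g₁ g₂
      refine Or.inr (Or.inr ⟨?_, ?_⟩) <;> nlinarith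
    · rw [abs_of_pos hpos] at g₁ g₂
      exact Or.inr (Or.inl ⟨lt_of_mul_lt_mul_left g₁ hpos.le, lt_of_mul_lt_mul_left g₂ hpos.le⟩)
  · have g₁ : α * v < -(|α| * C) := by linarith
    have g₂ : α * v' < -(|α| * C) := by linarith
    rcases lt_or_gt_of_ne hα with hneg | hpos
    · rw [abs_of_neg hneg] at g₁ g₂
      refine Or.inr (Or.inl ⟨?_, ?_⟩) <;> nlinarith
    · rw [abs_of_pos hpos] at g₁ g₂
      refine Or.inr (Or.inr ⟨?_, ?_⟩) <;> nlinarith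

/-- Values that move linearly, one of them towards zero: just when the first of them is small,
no truncated value has changed yet. -/
theorem exists_near {κ : Type} {C E : ℤ} (hC : 0 ≤ C) (p δ : κ → ℤ) (hδ : ∀ j, |δ j| ≤ E)
    {j₀ : κ} (h₀ : δ j₀ ≠ 0) (hsign : p j₀ * δ j₀ ≤ 0) :
    ∃ t : ℕ, (∀ j, SameTrunc C (p j) (p j + t * δ j)) ∧
      ∃ j, δ j ≠ 0 ∧ |p j + t * δ j| ≤ C + E := by
  classical
  have hex : ∃ t : ℕ, ∃ j, δ j ≠ 0 ∧ |p j + t * δ j| ≤ C + E := by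
    -- The quotient is nonpositive by the sign condition, so after this many steps the value is the
    -- remainder of p j₀ modulo δ j₀, which is below |δ j₀| ≤ E.
    refine ⟨(p j₀ / δ j₀).natAbs, j₀, h₀, ?_⟩
    have hq : p j₀ / δ j₀ ≤ 0 := by
      rcases lt_or_gt_of_ne h₀ with h | h
      · exact Int.ediv_nonpos_of_nonneg_of_nonpos (by nlinarith) h.le
      · rw [← Int.neg_nonneg]
        have : p j₀ ≤ 0 := by nlinarith
        have := Int.ediv_le_ediv h this
        simpa using this
    have he := Int.emod_add_mul_ediv (p j₀) (δ j₀)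
    have hr := Int.emod_nonneg (p j₀) h₀
    have hr' := Int.emod_lt_abs (p j₀) h₀
    rw [Int.natCast_natAbs, abs_of_nonpos hq]
    have : p j₀ + -(p j₀ / δ j₀) * δ j₀ = p j₀ % δ j₀ := by linarith
    rw [this, abs_of_nonneg hr]
    linarith [hδ j₀]
  refine ⟨Nat.find hex, fun j => ?_, Nat.find_spec hex⟩
  by_cases hj : δ j = 0
  · exact Or.inl (by simp [hj])
  have key : ∀ u, u ≤ Nat.find hex → SameTrunc C (p j) (p j + u * δ j) := by
    intro u
    induction u with
    | zero => exact fun _ => Or.inl (by simp)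
    | succ u ih =>
      intro hu
      refine (ih (by omega)).trans hC ?_
      -- By minimality of the stopping time, every moving value is still beyond C + E in absolute
      -- value; a step of size at most E leaves it beyond C on the same side.
      have hn := Nat.find_min hex (m := u) (by omega)
      simp only [not_exists, not_and, not_le] at hn
      have h1 := lt_abs.1 (hn j hj)
      have h2 := abs_le.1 (hδ j)
      have h3 : p j + ((u + 1 : ℕ) : ℤ) * δ j = p j + u * δ j + δ j := by push_cast; ring
      rw [h3]
      unfold SameTrunc
      omega
  exact key _ le_rfl

/-- With k the small value of form j and α, β the last coefficients of forms j and i, multiplying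
form i by α and substituting for αz leaves a form without z plus βk. As |k| is bounded, a larger
threshold absorbs βk, so one form per i suffices for all k at once. -/
theorem Tame.proj_branch {r l s : ℕ} (hl : 1 ≤ l) {κ : Type} [Fintype κ]
    {f : κ → Fin (r + 1) → ℤ} {D : ℕ} {W : Set (Fin (r + 1) → ℤ)} (hcard : Fintype.card κ ≤ s)
    (hD : 0 < D) (hDl : D ≤ 2 ^ l) (hf : ∀ j i, |f j i| ≤ 2 ^ l)
    (hW : ∀ a a', (∀ i, (D : ℤ) ∣ a' i - a i) →
      (∀ j, SameTrunc (2 ^ l) (lin (f j) a) (lin (f j) a')) → (a ∈ W ↔ a' ∈ W))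
    {j : κ} (hj : f j (Fin.last r) ≠ 0) :
    Tame s (4 * l) {a | ∃ z : ℤ, |lin (f j) (Fin.snoc (α := fun _ => ℤ) a z)| ≤
      2 ^ l + 2 ^ l * 2 ^ l ∧ Fin.snoc (α := fun _ => ℤ) a z ∈ W} := by
  set α := f j (Fin.last r) with hα
  have hbound := two_pow_bound hl
  have hpos : (0 : ℤ) < 2 ^ l := by positivity
  have hαl : |α| ≤ 2 ^ l := hf j _
  have hcube : (0 : ℤ) < 2 ^ l * (2 ^ l * 2 ^ l) := by positivity
  have hprod : ∀ x y : ℤ, |x| ≤ 2 ^ l → |y| ≤ 2 ^ l → |x * y| ≤ 2 ^ l * 2 ^ l := fun x y hx hy => by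
    rw [abs_mul]
    exact mul_le_mul hx hy (abs_nonneg _) hpos.le
  have hdir : ∀ a a' : Fin r → ℤ, (∀ i, α * D ∣ a' i - a i) →
      (∀ i, SameTrunc (2 ^ (4 * l))
        (α * lin (Fin.init (f i)) a - f i (Fin.last r) * lin (Fin.init (f j)) a)
        (α * lin (Fin.init (f i)) a' - f i (Fin.last r) * lin (Fin.init (f j)) a')) →
      (∃ z : ℤ, |lin (f j) (Fin.snoc (α := fun _ => ℤ) a z)| ≤
        2 ^ l + 2 ^ l * 2 ^ l ∧ Fin.snoc (α := fun _ => ℤ) a z ∈ W) →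
      ∃ z : ℤ, |lin (f j) (Fin.snoc (α := fun _ => ℤ) a' z)| ≤
        2 ^ l + 2 ^ l * 2 ^ l ∧ Fin.snoc (α := fun _ => ℤ) a' z ∈ W := by
    rintro a a' hmod htr ⟨z, hz, hzW⟩
    -- Congruence modulo αD, not just D, lets the witness for a' be z - Dq: it keeps the residue of
    -- z modulo D and gives form j exactly the same value k.
    obtain ⟨q, hq⟩ := dvd_lin_sub_lin (Fin.init (f j)) hmod
    have hz' : lin (f j) (Fin.snoc (α := fun _ => ℤ) a' (z - D * q)) =
        lin (f j) (Fin.snoc (α := fun _ => ℤ) a z) := by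
      rw [lin_snoc, lin_snoc, ← hα]
      linear_combination hq
    refine ⟨z - D * q, hz' ▸ hz, (hW _ _ (fun i => ?_) fun i => ?_).1 hzW⟩
    · refine Fin.lastCases ?_ (fun i => ?_) i
      · simp
      · simpa using (Dvd.intro_left α rfl).trans (hmod i)
    · set k := lin (f j) (Fin.snoc (α := fun _ => ℤ) a z) with hk
      set β := f i (Fin.last r) with hβ
      have hβk : |β * k| ≤ 2 ^ l * (2 ^ l + 2 ^ l * 2 ^ l) := by
        rw [abs_mul]
        exact mul_le_mul (hf i _) hz (abs_nonneg _) hpos.le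
      have e1 : α * lin (f i) (Fin.snoc (α := fun _ => ℤ) a z) =
          (α * lin (Fin.init (f i)) a - β * lin (Fin.init (f j)) a) + β * k := by
        rw [hk, lin_snoc, lin_snoc, ← hα, ← hβ]
        ring
      have e2 : α * lin (f i) (Fin.snoc (α := fun _ => ℤ) a' (z - D * q)) =
          (α * lin (Fin.init (f i)) a' - β * lin (Fin.init (f j)) a') + β * k := by
        rw [← hz', lin_snoc, lin_snoc, ← hα, ← hβ]
        ring
      generalize lin (f i) (Fin.snoc (α := fun _ => ℤ) a z) = v at *
      generalize lin (f i) (Fin.snoc (α := fun _ => ℤ) a' (z - D * q)) = v' at *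
      have hαC : |α| * 2 ^ l ≤ 2 ^ l * 2 ^ l := mul_le_mul_of_nonneg_right hαl hpos.le
      refine (htr i).of_mul hj e1 e2 ?_
      linarith
  refine ⟨κ, inferInstance, fun i i' => α * Fin.init (f i) i' -
    f i (Fin.last r) * Fin.init (f j) i', α.natAbs * D, hcard,
    Nat.mul_pos (Int.natAbs_pos.2 hj) hD, ?_, fun i i' => ?_, fun a a' hmod htr => ?_⟩
  · zify
    refine le_trans ?_ hbound
    have : |α| * (D : ℤ) ≤ 2 ^ l * 2 ^ l :=
      mul_le_mul hαl (by exact_mod_cast hDl) (by positivity) hpos.le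
    nlinarith
  · have h1 := hprod _ _ hαl (hf i (Fin.castSucc i'))
    have h2 := hprod _ _ (hf i (Fin.last r)) (hf j (Fin.castSucc i'))
    have h3 := abs_sub (α * Fin.init (f i) i') (f i (Fin.last r) * Fin.init (f j) i')
    simp only [Fin.init] at *
    linarith
  · simp only [lin_lincomb] at htr
    have hmod' : ∀ i, α * D ∣ a' i - a i := fun i => by
      refine dvd_trans ?_ (hmod i)
      push_cast
      exact mul_dvd_mul (self_dvd_abs α) dvd_rfl
    refine ⟨hdir a a' hmod' htr, hdir a' a (fun i => (dvd_sub_comm).1 (hmod' i)) fun i => ?_⟩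
    have := htr i
    unfold SameTrunc at *
    omega

theorem Tame.proj {r s l : ℕ} {W : Set (Fin (r + 1) → ℤ)} (h : Tame s l W) (hs : 1 ≤ s)
    (hl : 1 ≤ l) : TameUnion s s (4 * l) (proj W) := by
  classical
  obtain ⟨κ, _, f, D, hcard, hD, hDl, hf, hW⟩ := h
  by_cases hall : ∀ j, f j (Fin.last r) = 0
  · have : Tame s l (PA.proj W) := by
      refine ⟨κ, inferInstance, fun j => Fin.init (f j), D, hcard, hD, hDl,
        fun j i => hf j _, fun a a' hmod htr => exists_congr fun z => hW _ _ (fun i => ?_)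
        fun j => ?_⟩
      · refine Fin.lastCases ?_ (fun i => ?_) i
        · simp
        · simpa using hmod i
      · simpa [lin_snoc, hall j] using htr j
    exact this.tameUnion.mono hs le_rfl (by omega)
  · obtain ⟨j₀, hj₀⟩ := not_forall.1 hall
    refine ⟨{j // f j (Fin.last r) ≠ 0}, inferInstance, ⟨⟨j₀, hj₀⟩⟩, _,
      (Fintype.card_subtype_le _).trans hcard, ?_,
      fun j => Tame.proj_branch hl hcard hD hDl hf hW j.2⟩
    ext a
    simp only [Set.mem_iUnion, Set.mem_ofPred_eq, PA.proj]
    constructor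
    · rintro ⟨z, hz⟩
      have hmain : ∀ ε : ℤ, |ε| = 1 → lin (f j₀) (Fin.snoc (α := fun _ => ℤ) a z) *
          (ε * D * f j₀ (Fin.last r)) ≤ 0 → ∃ i : {j // f j (Fin.last r) ≠ 0}, ∃ z : ℤ,
          |lin (f i) (Fin.snoc (α := fun _ => ℤ) a z)| ≤ 2 ^ l + 2 ^ l * 2 ^ l ∧
            Fin.snoc (α := fun _ => ℤ) a z ∈ W := by
        intro ε hε hsign
        have hε0 : ε ≠ 0 := by rintro rfl; simp at hε
        have hD0 : (D : ℤ) ≠ 0 := by exact_mod_cast hD.ne'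
        obtain ⟨t, ht, j, hj, hjt⟩ := exists_near (C := 2 ^ l) (E := 2 ^ l * 2 ^ l) (by positivity)
          (fun j => lin (f j) (Fin.snoc (α := fun _ => ℤ) a z))
          (fun j => ε * D * f j (Fin.last r)) (fun j => by
            rw [abs_mul, abs_mul, hε, one_mul]
            refine mul_le_mul ?_ (hf j _) (abs_nonneg _) (by positivity)
            rw [abs_of_nonneg (by positivity)]
            exact_mod_cast hDl) (mul_ne_zero (mul_ne_zero hε0 hD0) hj₀) hsign
        have hmove : ∀ j, lin (f j) (Fin.snoc (α := fun _ => ℤ) a (z + t * (ε * D))) =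
            lin (f j) (Fin.snoc (α := fun _ => ℤ) a z) + t * (ε * D * f j (Fin.last r)) := by
          intro j
          rw [lin_snoc, lin_snoc]
          ring
        refine ⟨⟨j, fun h => hj (by rw [h, mul_zero])⟩, z + t * (ε * D), ?_, ?_⟩
        · rw [hmove]
          exact hjt
        · refine (hW _ _ (fun i => ?_) fun j => ?_).1 hz
          · refine Fin.lastCases ?_ (fun i => ?_) i
            · simp only [Fin.snoc_last]
              exact ⟨t * ε, by ring⟩
            · simp
          · rw [hmove]
            exact ht j
      -- The direction of motion is chosen so that form j₀ moves towards zero, as `exists_near`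
      -- requires.
      rcases le_total (lin (f j₀) (Fin.snoc (α := fun _ => ℤ) a z) *
          (D * f j₀ (Fin.last r))) 0 with h | h
      · exact hmain 1 (by simp) (by simpa using h)
      · refine hmain (-1) (by simp) ?_
        linarith
    · rintro ⟨_, z, -, hz⟩
      exact ⟨z, hz⟩

theorem TameUnion.proj {r N s l : ℕ} {U : Set (Fin (r + 1) → ℤ)} (h : TameUnion N s l U)
    (hs : 1 ≤ s) (hl : 1 ≤ l) : TameUnion (N * s) s (4 * l) (proj U) := by
  obtain ⟨ι, _, ⟨i₀⟩, W, hc, rfl, hW⟩ := h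
  choose κ hκ hne V hcard hV hVt using fun i => (hW i).proj hs hl
  obtain ⟨k₀⟩ := hne i₀
  refine ⟨Σ i, κ i, inferInstance, ⟨⟨i₀, k₀⟩⟩, fun p => V p.1 p.2, ?_, ?_, fun p => hVt p.1 p.2⟩
  · rw [Fintype.card_sigma]
    refine (Finset.sum_le_card_nsmul _ _ s fun i _ => hcard i).trans ?_
    rw [smul_eq_mul]
    exact Nat.mul_le_mul_right s hc
  · ext a
    simp only [Set.mem_iUnion, Sigma.exists]
    have : ∀ i, (∃ k, a ∈ V i k) ↔ a ∈ PA.proj (W i) := fun i => by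
      rw [hV i, Set.mem_iUnion]
    simp only [this, PA.proj, Set.mem_iUnion, Set.mem_ofPred_eq]
    exact exists_comm

/-! ### Terms and atomic formulas -/

/-- The coefficients of the linear polynomial given by a term. -/
def Term.coeff {r : ℕ} : Term r → Fin r → ℤ
  | .var i => Pi.single i 1
  | .zero => 0
  | .one => 0
  | .neg t => -t.coeff
  | .add s t => s.coeff + t.coeff

/-- The constant part of the linear polynomial given by a term. -/
def Term.const {r : ℕ} : Term r → ℤ
  | .var _ => 0
  | .zero => 0
  | .one => 1
  | .neg t => -t.const
  | .add s t => s.const + t.const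

theorem Term.eval_eq {r : ℕ} (t : Term r) (a : Fin r → ℤ) :
    t.eval a = lin t.coeff a + t.const := by
  induction t with
  | var i => simp [eval, coeff, const, lin, Pi.single_apply]
  | zero => simp [eval, coeff, const, lin]
  | one => simp [eval, coeff, const, lin]
  | neg t ih => simp only [eval, coeff, const, ih, lin, Pi.neg_apply, neg_mul,
      Finset.sum_neg_distrib]; ring
  | add s t ihs iht => simp only [eval, coeff, const, ihs, iht, lin, Pi.add_apply, add_mul,
      Finset.sum_add_distrib]; ring

/-- A term with k leaves has at least k - 1 binary operations, and each leaf contributes at most 1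
to the norm. -/
theorem Term.norm_le {r : ℕ} (t : Term r) :
    2 * (∑ i, |t.coeff i| + |t.const|) ≤ t.length + 1 := by
  induction t with
  | var i => simp [coeff, const, length, Pi.single_apply, apply_ite abs]
  | zero => simp [coeff, const, length]
  | one => simp [coeff, const, length]
  | neg t ih =>
    simp only [coeff, const, length, Pi.neg_apply, abs_neg]
    push_cast
    linarith
  | add s t ihs iht =>
    simp only [coeff, const, length, Pi.add_apply]
    have h1 : ∑ i, |s.coeff i + t.coeff i| ≤ ∑ i, |s.coeff i| + ∑ i, |t.coeff i| := by
      rw [← Finset.sum_add_distrib]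
      exact Finset.sum_le_sum fun i _ => abs_add_le _ _
    have h2 := abs_add_le s.const t.const
    push_cast
    linarith

theorem norm_sub_le {r : ℕ} (s t : Term r) :
    2 * (∑ i, |(s.coeff - t.coeff) i| + |s.const - t.const|) ≤ s.length + t.length + 2 := by
  have h1 : ∑ i, |(s.coeff - t.coeff) i| ≤ ∑ i, |s.coeff i| + ∑ i, |t.coeff i| := by
    rw [← Finset.sum_add_distrib]
    exact Finset.sum_le_sum fun i _ => abs_sub _ _
  have h2 := abs_sub s.const t.const
  have h3 := s.norm_le
  have h4 := t.norm_le
  linarith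

theorem Term.one_le_length {r : ℕ} (t : Term r) : 1 ≤ t.length := by
  cases t <;> simp only [length] <;> omega

theorem eval_sub_eval {r : ℕ} (s t : Term r) (a : Fin r → ℤ) :
    s.eval a - t.eval a = lin (s.coeff - t.coeff) a + (s.const - t.const) := by
  rw [s.eval_eq, t.eval_eq]
  have : lin (s.coeff - t.coeff) a = lin s.coeff a - lin t.coeff a := by
    have h := lin_lincomb 1 1 s.coeff t.coeff a
    simp only [one_mul] at h
    exact h
  rw [this]
  ring

theorem Rel.holds_congr (R : Rel) {x y x' y' v v' c : ℤ} (h : x - y = v + c)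
    (h' : x' - y' = v' + c) (hv : SameTrunc |c| v v') : R.holds x y ↔ R.holds x' y' := by
  have h1 := neg_abs_le c
  have h2 := le_abs_self c
  generalize |c| = C at *
  unfold SameTrunc at hv
  cases R <;> simp only [holds] <;> omega

theorem Term.dvd_eval_iff {r : ℕ} (t : Term r) {d : ℤ} {a a' : Fin r → ℤ}
    (h : ∀ i, d ∣ a' i - a i) : d ∣ t.eval a ↔ d ∣ t.eval a' := by
  have := dvd_lin_sub_lin t.coeff h
  rw [t.eval_eq, t.eval_eq, dvd_iff_dvd_of_dvd_sub]
  rw [dvd_sub_comm]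
  simpa using this

namespace Formula

theorem tame_rel {r : ℕ} (R : Rel) (s t : Term r) {n : ℕ} (h : s.length + 1 + t.length ≤ n) :
    Tame 1 n (rel R s t).solutions := by
  have hn := norm_sub_le s t
  have hnn : (n : ℤ) ≤ 2 ^ n := by exact_mod_cast n.lt_two_pow_self.le
  have hs := s.one_le_length
  have ht := t.one_le_length
  have hn' : ∑ i, |(s.coeff - t.coeff) i| + |s.const - t.const| ≤ n := by omega
  refine ⟨Unit, inferInstance, fun _ => s.coeff - t.coeff, 1, by simp, one_pos,
    Nat.one_le_two_pow, fun _ i => ?_, fun a a' _ htr => ?_⟩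
  · have := Finset.single_le_sum (f := fun i => |(s.coeff - t.coeff) i|)
      (fun i _ => abs_nonneg _) (Finset.mem_univ i)
    have := abs_nonneg (s.const - t.const)
    simp only at *
    omega
  · refine R.holds_congr (eval_sub_eval s t a) (eval_sub_eval s t a') ((htr ()).mono ?_)
    have := Finset.sum_nonneg (s := Finset.univ) fun i _ => abs_nonneg ((s.coeff - t.coeff) i)
    omega

theorem tame_dvd {r : ℕ} {d : ℕ} (hd : 2 ≤ d) (t : Term r) {n : ℕ} (h : d ≤ n) :
    Tame 1 n (dvd d hd t).solutions :=
  ⟨Empty, inferInstance, fun e => e.elim, d, by simp, by omega,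
    h.trans n.lt_two_pow_self.le, fun e => e.elim, fun _ _ hmod _ => t.dvd_eval_iff hmod⟩

/-! ### Syntactic measures -/

/-- The number of atomic subformulas. -/
def numAtoms : {r : ℕ} → Formula r → ℕ
  | _, rel _ _ _ => 1
  | _, dvd _ _ _ => 1
  | _, not φ => φ.numAtoms
  | _, and φ ψ => φ.numAtoms + ψ.numAtoms
  | _, or φ ψ => φ.numAtoms + ψ.numAtoms
  | _, imp φ ψ => φ.numAtoms + ψ.numAtoms
  | _, iff φ ψ => φ.numAtoms + ψ.numAtoms
  | _, quant _ φ => φ.numAtoms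

theorem one_le_numAtoms {r : ℕ} (φ : Formula r) : 1 ≤ φ.numAtoms := by
  induction φ <;> simp only [numAtoms] <;> omega

theorem two_mul_numAtoms_le {r : ℕ} (φ : Formula r) : 2 * φ.numAtoms ≤ φ.length := by
  induction φ with
  | rel R s t =>
    have := s.one_le_length
    have := t.one_le_length
    simp only [numAtoms, length]
    omega
  | dvd d hd t => simp only [numAtoms, length]; omega
  | _ => simp only [numAtoms, length]; omega

theorem three_le_length {r : ℕ} (φ : Formula r) : 3 ≤ φ.length := by
  induction φ with
  | rel R s t =>
    have := s.one_le_length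
    have := t.one_le_length
    simp only [length]
    omega
  | dvd d hd t => simp only [length]; omega
  | _ => simp only [length]; omega

theorem mem_subformulas_self {r : ℕ} (φ : Formula r) : ⟨r, φ⟩ ∈ φ.subformulas := by
  cases φ <;> simp [subformulas]

theorem qbl_le_iff {r : ℕ} {φ : Formula r} {b : ℕ} :
    φ.qbl ≤ b ↔ ∀ ψ ∈ φ.subformulas, ∀ Q, ψ.2.qblQ Q ≤ b := by
  have key : ∀ l : List ℕ, l.foldr max 0 ≤ b ↔ ∀ x ∈ l, x ≤ b := fun l => by
    induction l <;> simp_all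
  rw [qbl, key]
  simp only [List.mem_map, forall_exists_index, and_imp, forall_apply_eq_imp_iff₂, max_le_iff]
  exact forall₂_congr fun ψ _ => ⟨fun h Q => by cases Q; exacts [h.1, h.2], fun h => ⟨h _, h _⟩⟩

theorem qblQ_le_qbl {r : ℕ} (φ : Formula r) (Q : Quant) : φ.qblQ Q ≤ φ.qbl :=
  qbl_le_iff.1 le_rfl _ φ.mem_subformulas_self Q

theorem qbl_le_of_subset {r r' : ℕ} {φ : Formula r} {ψ : Formula r'}
    (h : φ.subformulas ⊆ ψ.subformulas) : φ.qbl ≤ ψ.qbl :=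
  qbl_le_iff.2 fun _ hχ => qbl_le_iff.1 le_rfl _ (h hχ)

/-- The solutions of `φ`, or of its negation when the outermost block is universal. -/
def modeSet {r : ℕ} (φ : Formula r) : Quant → Set (Fin r → ℤ)
  | .ex => φ.solutions
  | .all => φ.solutionsᶜ

theorem modeSet_dual {r : ℕ} (φ : Formula r) (Q : Quant) :
    φ.modeSet Q.dual = (φ.modeSet Q)ᶜ := by
  cases Q
  · rfl
  · exact (compl_compl _).symm

theorem modeSet_not {r : ℕ} (φ : Formula r) (Q : Quant) :
    (not φ).modeSet Q = φ.modeSet Q.dual := by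
  cases Q
  · rfl
  · exact compl_compl _

theorem modeSet_quant {r : ℕ} (φ : Formula (r + 1)) (Q : Quant) :
    (quant Q φ).modeSet Q = proj (φ.modeSet Q) := by
  cases Q
  · rfl
  · ext a
    exact not_forall

theorem tame_solutions_of_modeSet {r s l : ℕ} {φ : Formula r} {Q : Quant}
    (h : Tame s l (φ.modeSet Q)) : Tame s l φ.solutions := by
  cases Q
  · exact h
  · simpa [modeSet] using h.compl

theorem tame_modeSet {r s l : ℕ} {φ : Formula r} (h : Tame s l φ.solutions) (Q : Quant) :
    Tame s l (φ.modeSet Q) := by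
  cases Q
  · exact h
  · exact h.compl

end Formula

/-! ### Bounds for quantifier blocks -/

/-- Bound for the number of linear forms after eliminating `d` quantifier blocks. -/
def formBound (n b : ℕ) : ℕ → ℕ
  | 0 => 1
  | d + 1 => (n ^ b * formBound n b d) ^ (b + 1)

/-- Bound for the bit size of coefficients and moduli after eliminating `d` quantifier blocks. -/
def sizeBound (n b : ℕ) : ℕ → ℕ
  | 0 => n
  | d + 1 => (n ^ b * formBound n b d) ^ b * (n ^ b * n ^ b * sizeBound n b d)

theorem one_le_formBound {n : ℕ} (hn : 1 ≤ n) (b d : ℕ) : 1 ≤ formBound n b d := by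
  induction d with
  | zero => exact le_rfl
  | succ d ih => exact Nat.one_le_pow _ _ (Nat.mul_pos (Nat.pow_pos hn) ih)

theorem formBound_mono {n : ℕ} (hn : 1 ≤ n) (b : ℕ) : Monotone (formBound n b) := by
  refine monotone_nat_of_le_succ fun d => ?_
  have h1 := one_le_formBound hn b d
  calc formBound n b d ≤ n ^ b * formBound n b d := Nat.le_mul_of_pos_left _ (Nat.pow_pos hn)
    _ ≤ _ := Nat.le_self_pow (Nat.succ_ne_zero b) _

theorem sizeBound_mono {n : ℕ} (hn : 1 ≤ n) (b : ℕ) : Monotone (sizeBound n b) := by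
  refine monotone_nat_of_le_succ fun d => ?_
  have h1 := one_le_formBound hn b d
  have h2 : 0 < n ^ b := Nat.pow_pos hn
  rw [sizeBound, ← mul_assoc]
  exact Nat.le_mul_of_pos_left _ (by positivity)

theorem le_sizeBound {n : ℕ} (hn : 1 ≤ n) (b d : ℕ) : n ≤ sizeBound n b d :=
  sizeBound_mono hn b (Nat.zero_le d)

/-- The bounds inside a quantifier block, where `d` blocks have been eliminated before, `u`
quantifiers of the block have been eliminated, and `c` subformulas have been combined. -/
def BlockBound (n b d u c : ℕ) {r : ℕ} (U : Set (Fin r → ℤ)) : Prop :=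
  TameUnion ((n ^ b * formBound n b d) ^ u) (c * formBound n b d) (4 ^ u * c * sizeBound n b d) U

theorem BlockBound.mono {n b d u c d' c' r : ℕ} (hn : 1 ≤ n) {U : Set (Fin r → ℤ)}
    (h : BlockBound n b d u c U) (hd : d ≤ d') (hc : c ≤ c') : BlockBound n b d' u c' U := by
  have hs := formBound_mono hn b hd
  have hl := sizeBound_mono hn b hd
  refine TameUnion.mono h ?_ ?_ ?_
  · gcongr
  · gcongr
  · gcongr

theorem blockBound_add_le {d₁ d₂ u₁ u₂ c₁ c₂ : ℕ} {n : ℕ} (hn : 1 ≤ n) (b : ℕ) :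
    (n ^ b * formBound n b d₁) ^ u₁ * (n ^ b * formBound n b d₂) ^ u₂ ≤
      (n ^ b * formBound n b (max d₁ d₂)) ^ (u₁ + u₂) ∧
    c₁ * formBound n b d₁ + c₂ * formBound n b d₂ ≤ (c₁ + c₂) * formBound n b (max d₁ d₂) ∧
    4 ^ u₁ * c₁ * sizeBound n b d₁ + 4 ^ u₂ * c₂ * sizeBound n b d₂ ≤
      4 ^ (u₁ + u₂) * (c₁ + c₂) * sizeBound n b (max d₁ d₂) := by
  have hs₁ := formBound_mono hn b (le_max_left d₁ d₂)
  have hs₂ := formBound_mono hn b (le_max_right d₁ d₂)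
  have hl₁ := sizeBound_mono hn b (le_max_left d₁ d₂)
  have hl₂ := sizeBound_mono hn b (le_max_right d₁ d₂)
  refine ⟨?_, ?_, ?_⟩
  · rw [pow_add]
    gcongr
  · rw [add_mul]
    gcongr
  · rw [mul_add, add_mul]
    have h4 : 1 ≤ 4 := by norm_num
    gcongr <;> omega

theorem BlockBound.inter {n b r d₁ u₁ c₁ d₂ u₂ c₂ : ℕ} (hn : 1 ≤ n) {U₁ U₂ : Set (Fin r → ℤ)}
    (h₁ : BlockBound n b d₁ u₁ c₁ U₁) (h₂ : BlockBound n b d₂ u₂ c₂ U₂) :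
    BlockBound n b (max d₁ d₂) (u₁ + u₂) (c₁ + c₂) (U₁ ∩ U₂) :=
  have h := blockBound_add_le hn b
  (TameUnion.inter h₁ h₂).mono h.1 h.2.1 h.2.2

theorem BlockBound.union {n b r d₁ u₁ c₁ d₂ u₂ c₂ : ℕ} (hn : 1 ≤ n) {U₁ U₂ : Set (Fin r → ℤ)}
    (h₁ : BlockBound n b d₁ u₁ c₁ U₁) (h₂ : BlockBound n b d₂ u₂ c₂ U₂) :
    BlockBound n b (max d₁ d₂) (u₁ + u₂) (c₁ + c₂) (U₁ ∪ U₂) :=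
  have h := blockBound_add_le hn b
  (TameUnion.union h₁ h₂).mono h.1 h.2.1 h.2.2

theorem BlockBound.tame {n b r d c : ℕ} {U : Set (Fin r → ℤ)} (h : BlockBound n b d 0 c U) :
    Tame (c * formBound n b d) (c * sizeBound n b d) U := by
  simpa using TameUnion.tame_of_le_one h (by simp)

theorem blockBound_zero {n b r d c : ℕ} {U : Set (Fin r → ℤ)}
    (h : Tame (c * formBound n b d) (c * sizeBound n b d) U) : BlockBound n b d 0 c U := by
  simpa [BlockBound] using h.tameUnion

theorem BlockBound.proj {n b r d u c : ℕ} {U : Set (Fin (r + 1) → ℤ)} (hn : 1 ≤ n) (hc : 1 ≤ c)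
    (hcn : c ≤ n ^ b) (h : BlockBound n b d u c U) : BlockBound n b d (u + 1) c (proj U) := by
  have hs := one_le_formBound hn b d
  have hl := hn.trans (le_sizeBound hn b d)
  have h4 : 0 < 4 ^ u := by positivity
  refine (TameUnion.proj h (Nat.mul_pos hc hs) (Nat.mul_pos (Nat.mul_pos h4 hc) hl)).mono
    ?_ le_rfl (le_of_eq (by ring))
  rw [pow_succ]
  gcongr

/-- Closes a block by merging its union. The hypothesis n ≥ 4 absorbs the factor 4 ^ u into n ^ b.
-/
theorem BlockBound.tame_succ {n b r d u c : ℕ} {U : Set (Fin r → ℤ)} (hn : 4 ≤ n) (hu : u ≤ b)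
    (hcn : c ≤ n ^ b) (h : BlockBound n b d u c U) :
    Tame (formBound n b (d + 1)) (sizeBound n b (d + 1)) U := by
  have hs := one_le_formBound (by omega : 1 ≤ n) b d
  have hX : 1 ≤ n ^ b * formBound n b d := Nat.mul_pos (Nat.pow_pos (by omega)) hs
  refine (TameUnion.tame h).mono ?_ ?_
  · rw [formBound, pow_succ]
    gcongr
  · rw [sizeBound]
    have h4 : 4 ^ u ≤ n ^ b := (Nat.pow_le_pow_left hn u).trans
      (Nat.pow_le_pow_right (by omega) hu)
    gcongr

/-- The factor by which the clause for `↔` can multiply the number of subformulas, in terms of the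
two block lengths. -/
def weight (u w : ℕ) : ℕ := if u = 0 then 1 else if w = 0 then 2 * u - 1 else 2 * u

theorem one_le_weight (u w : ℕ) : 1 ≤ weight u w := by
  unfold weight
  split_ifs <;> omega

theorem weight_le {u b : ℕ} (w : ℕ) (hb : 1 ≤ b) (hu : u ≤ b) : weight u w ≤ 2 * b := by
  unfold weight
  split_ifs <;> omega

theorem weight_mono {u w u' w' : ℕ} (hu : u ≤ u') (hw : w ≤ w') : weight u w ≤ weight u' w' := by
  unfold weight
  split_ifs <;> omega

theorem weight_add_le (k₁ k₂ u₁ w₁ u₂ w₂ : ℕ) :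
    k₁ * weight u₁ w₁ + k₂ * weight u₂ w₂ ≤ (k₁ + k₂) * weight (u₁ + u₂) (w₁ + w₂) := by
  rw [add_mul]
  exact Nat.add_le_add
    (Nat.mul_le_mul_left _ (weight_mono (Nat.le_add_right _ _) (Nat.le_add_right _ _)))
    (Nat.mul_le_mul_left _ (weight_mono (Nat.le_add_left _ _) (Nat.le_add_left _ _)))

/-- A side of `↔` is used in both modes. The value 2u - 1 in `weight` makes room for the other mode,
which still costs 1 when its block length is 0. -/
theorem weight_add_swap_le {u w t : ℕ} (h : u + w ≤ t) (ht : 1 ≤ t) :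
    weight u w + weight w u ≤ weight t t := by
  unfold weight
  split_ifs <;> omega

theorem weight_le_succ (u w : ℕ) : weight u w ≤ weight (u + 1) 0 := by
  rw [weight, weight, if_neg (Nat.succ_ne_zero u), if_pos rfl]
  split_ifs <;> omega

/-! ### Induction on formulas in both modes -/

namespace Formula

/-- The block bounds for `φ` in the mode `Q`, in terms of its syntactic measures. -/
def ModeBound (n b : ℕ) {r : ℕ} (φ : Formula r) (Q : Quant) : Prop :=
  BlockBound n b (φ.qaQ Q) (φ.qblQ Q) (φ.numAtoms * weight (φ.qblQ Q) (φ.qblQ Q.dual))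
    (φ.modeSet Q)

theorem modeBound_not {n b r : ℕ} {φ : Formula r} (h : ∀ Q, φ.ModeBound n b Q) (Q : Quant) :
    (not φ).ModeBound n b Q := by
  have h' := h Q.dual
  unfold ModeBound at *
  rwa [modeSet_not]

theorem modeBound_or {n b r : ℕ} (hn : 1 ≤ n) {φ ψ : Formula r} (h₁ : ∀ Q, φ.ModeBound n b Q)
    (h₂ : ∀ Q, ψ.ModeBound n b Q) (Q : Quant) : (or φ ψ).ModeBound n b Q := by
  cases Q
  · exact (BlockBound.union hn (h₁ .ex) (h₂ .ex)).mono hn le_rfl (weight_add_le ..)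
  · have h := (BlockBound.inter hn (h₁ .all) (h₂ .all)).mono hn le_rfl (weight_add_le ..)
    have e : (or φ ψ).modeSet .all = φ.modeSet .all ∩ ψ.modeSet .all := by
      ext a
      exact not_or
    unfold ModeBound
    rw [e]
    exact h

theorem modeBound_and {n b r : ℕ} (hn : 1 ≤ n) {φ ψ : Formula r} (h₁ : ∀ Q, φ.ModeBound n b Q)
    (h₂ : ∀ Q, ψ.ModeBound n b Q) (Q : Quant) : (and φ ψ).ModeBound n b Q := by
  cases Q
  · exact (BlockBound.inter hn (h₁ .ex) (h₂ .ex)).mono hn le_rfl (weight_add_le ..)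
  · have h := (BlockBound.union hn (h₁ .all) (h₂ .all)).mono hn le_rfl (weight_add_le ..)
    have e : (and φ ψ).modeSet .all = φ.modeSet .all ∪ ψ.modeSet .all := by
      ext a
      exact Classical.not_and_iff_not_or_not
    unfold ModeBound
    rw [e]
    exact h

theorem modeBound_imp {n b r : ℕ} (hn : 1 ≤ n) {φ ψ : Formula r} (h₁ : ∀ Q, φ.ModeBound n b Q)
    (h₂ : ∀ Q, ψ.ModeBound n b Q) (Q : Quant) : (imp φ ψ).ModeBound n b Q := by
  have h := modeBound_or hn (modeBound_not h₁) h₂ Q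
  have e : (imp φ ψ).solutions = (or (not φ) ψ).solutions := by
    ext a
    exact imp_iff_not_or
  have e' : (imp φ ψ).modeSet Q = (or (not φ) ψ).modeSet Q := by
    cases Q <;> simp only [modeSet, e]
  unfold ModeBound at *
  rw [e']
  exact h

theorem modeSet_iff {r : ℕ} (φ ψ : Formula r) :
    (iff φ ψ).modeSet .ex =
      (φ.modeSet .all ∪ ψ.modeSet .ex) ∩ (ψ.modeSet .all ∪ φ.modeSet .ex) ∧
    (iff φ ψ).modeSet .all =
      (φ.modeSet .ex ∩ ψ.modeSet .all) ∪ (ψ.modeSet .ex ∩ φ.modeSet .all) := by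
  constructor <;> ext a <;>
    simp only [modeSet, solutions, Sat, Set.mem_inter_iff, Set.mem_union, Set.mem_compl_iff,
      Set.mem_ofPred_eq] <;> tauto

theorem modeBound_iff {n b r : ℕ} (hn : 1 ≤ n) {φ ψ : Formula r} (h₁ : ∀ Q, φ.ModeBound n b Q)
    (h₂ : ∀ Q, ψ.ModeBound n b Q) (Q : Quant) : (iff φ ψ).ModeBound n b Q := by
  obtain ⟨e₁, e₂⟩ := modeSet_iff φ ψ
  have hex₁ := h₁ .ex
  have hall₁ := h₁ .all
  have hex₂ := h₂ .ex
  have hall₂ := h₂ .all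
  unfold ModeBound at hex₁ hall₁ hex₂ hall₂
  simp only [Quant.dual] at hex₁ hall₁ hex₂ hall₂
  have hmax : ∀ Q, max (φ.qaQ .ex) (ψ.qaQ .ex) ≤ (iff φ ψ).qaQ Q := by
    intro Q
    cases Q <;> simp only [qaQ, Quant.dual] <;> omega
  -- If all block lengths vanish, both sides are single tame sets and determine the equivalence
  -- directly, so no atom is counted twice. Otherwise each side is used in both modes, and the
  -- growing block length pays for the doubling through `weight`.
  by_cases h0 : φ.qblQ .ex + φ.qblQ .all + (ψ.qblQ .ex + ψ.qblQ .all) = 0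
  · have hu₁ : φ.qblQ .ex = 0 := by omega
    have hv₁ : φ.qblQ .all = 0 := by omega
    have hu₂ : ψ.qblQ .ex = 0 := by omega
    have hv₂ : ψ.qblQ .all = 0 := by omega
    have hbl : ∀ Q, (iff φ ψ).qblQ Q = 0 := by
      intro Q
      cases Q <;> simp only [qblQ, Quant.dual, hu₁, hv₁, hu₂, hv₂]
    rw [hu₁, hv₁] at hex₁
    rw [hu₂, hv₂] at hex₂
    have ht := hex₁.tame.comb hex₂.tame (W := (iff φ ψ).solutions)
      fun a a' h h' => iff_congr h h'
    have hle := blockBound_add_le (d₁ := φ.qaQ .ex) (d₂ := ψ.qaQ .ex) (u₁ := 0) (u₂ := 0)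
      (c₁ := φ.numAtoms * weight 0 0) (c₂ := ψ.numAtoms * weight 0 0) hn b
    have ht' := blockBound_zero (tame_modeSet (ht.mono hle.2.1 (by simpa using hle.2.2)) Q)
    unfold ModeBound
    rw [hbl, hbl]
    refine ht'.mono hn (hmax Q) ?_
    rw [← add_mul]
    exact le_rfl
  · have hw : ∀ Q, (φ.numAtoms * weight (φ.qblQ .ex) (φ.qblQ .all) +
        φ.numAtoms * weight (φ.qblQ .all) (φ.qblQ .ex)) +
        (ψ.numAtoms * weight (ψ.qblQ .ex) (ψ.qblQ .all) +
        ψ.numAtoms * weight (ψ.qblQ .all) (ψ.qblQ .ex)) ≤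
        (iff φ ψ).numAtoms * weight ((iff φ ψ).qblQ Q) ((iff φ ψ).qblQ Q.dual) := by
      intro Q
      have hd : (iff φ ψ).qblQ Q = φ.qblQ .ex + φ.qblQ .all + (ψ.qblQ .ex + ψ.qblQ .all) := by
        cases Q <;> simp only [qblQ, Quant.dual] <;> omega
      have hd' : (iff φ ψ).qblQ Q.dual =
          φ.qblQ .ex + φ.qblQ .all + (ψ.qblQ .ex + ψ.qblQ .all) := by
        cases Q <;> simp only [qblQ, Quant.dual] <;> omega
      rw [hd, hd', numAtoms, add_mul, ← mul_add, ← mul_add]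
      exact Nat.add_le_add
        (Nat.mul_le_mul_left _ (weight_add_swap_le (by omega) (by omega)))
        (Nat.mul_le_mul_left _ (weight_add_swap_le (by omega) (by omega)))
    cases Q
    · have h := (hall₁.union hn hex₂).inter hn (hall₂.union hn hex₁)
      unfold ModeBound
      rw [e₁]
      exact h.mono hn le_rfl (le_trans (by omega) (hw .ex))
    · have h := (hex₁.inter hn hall₂).union hn (hex₂.inter hn hall₁)
      unfold ModeBound
      rw [e₂]
      exact h.mono hn le_rfl (le_trans (by omega) (hw .all))

theorem modeBound_quant_self {n b r : ℕ} (hn : 1 ≤ n) {φ : Formula (r + 1)} {Q : Quant}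
    (h : φ.ModeBound n b Q)
    (hc : φ.numAtoms * weight (φ.qblQ Q + 1) 0 ≤ n ^ b) :
    BlockBound n b (φ.qaQ Q) (φ.qblQ Q + 1) (φ.numAtoms * weight (φ.qblQ Q + 1) 0)
      ((quant Q φ).modeSet Q) := by
  rw [modeSet_quant]
  exact (BlockBound.mono hn h le_rfl (Nat.mul_le_mul_left _ (weight_le_succ _ _))).proj hn
    (Nat.mul_pos φ.one_le_numAtoms (one_le_weight _ _)) hc

theorem numAtoms_mul_weight_le {n b r u w : ℕ} {φ : Formula r} (hb : 1 ≤ b)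
    (hnb : b * n ≤ n ^ b) (hu : u ≤ b) (hl : φ.length ≤ n) :
    φ.numAtoms * weight u w ≤ n ^ b := by
  refine le_trans ?_ hnb
  have h1 := φ.two_mul_numAtoms_le
  calc φ.numAtoms * weight u w ≤ φ.numAtoms * (2 * b) := Nat.mul_le_mul_left _ (weight_le w hb hu)
    _ = b * (2 * φ.numAtoms) := by ring
    _ ≤ b * n := Nat.mul_le_mul_left _ (by omega)

theorem modeBound {n b r : ℕ} (hb : 1 ≤ b) (hn : 4 ≤ n) (hnb : b * n ≤ n ^ b) (φ : Formula r)
    (hqbl : φ.qbl ≤ b) (hl : φ.length ≤ n) (Q : Quant) : φ.ModeBound n b Q := by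
  have hn1 : 1 ≤ n := by omega
  have hatom : ∀ {r : ℕ} {U : Set (Fin r → ℤ)}, Tame 1 n U → BlockBound n b 0 0 1 U :=
    fun h => blockBound_zero (by simpa [formBound, sizeBound] using h)
  induction φ generalizing Q with
  | rel R s t => exact hatom (tame_modeSet (tame_rel R s t hl) Q)
  | dvd d hd t =>
    refine hatom (tame_modeSet (tame_dvd hd t ?_) Q)
    simp only [length] at hl
    omega
  | not φ ih =>
    simp only [length] at hl
    exact modeBound_not (ih ((qbl_le_of_subset (by simp [subformulas])).trans hqbl) (by omega)) Q
  | and φ ψ ih₁ ih₂ =>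
    simp only [length] at hl
    exact modeBound_and hn1
      (ih₁ ((qbl_le_of_subset (by simp [subformulas])).trans hqbl) (by omega))
      (ih₂ ((qbl_le_of_subset (by simp [subformulas])).trans hqbl) (by omega)) Q
  | or φ ψ ih₁ ih₂ =>
    simp only [length] at hl
    exact modeBound_or hn1
      (ih₁ ((qbl_le_of_subset (by simp [subformulas])).trans hqbl) (by omega))
      (ih₂ ((qbl_le_of_subset (by simp [subformulas])).trans hqbl) (by omega)) Q
  | imp φ ψ ih₁ ih₂ =>
    simp only [length] at hl
    exact modeBound_imp hn1
      (ih₁ ((qbl_le_of_subset (by simp [subformulas])).trans hqbl) (by omega))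
      (ih₂ ((qbl_le_of_subset (by simp [subformulas])).trans hqbl) (by omega)) Q
  | iff φ ψ ih₁ ih₂ =>
    simp only [length] at hl
    exact modeBound_iff hn1
      (ih₁ ((qbl_le_of_subset (by simp [subformulas])).trans hqbl) (by omega))
      (ih₂ ((qbl_le_of_subset (by simp [subformulas])).trans hqbl) (by omega)) Q
  | quant Q' φ ih =>
    simp only [length] at hl
    have hself := (quant Q' φ).qblQ_le_qbl Q'
    simp only [qblQ, if_true] at hself
    have hu : φ.qblQ Q' + 1 ≤ b := by omega
    have hc := numAtoms_mul_weight_le (w := 0) (φ := φ) hb hnb hu (by omega)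
    have h := modeBound_quant_self hn1
      (ih ((qbl_le_of_subset (by simp [subformulas])).trans hqbl) (by omega) Q') hc
    by_cases hQ : Q' = Q
    · subst hQ
      have hdual : Q' ≠ Q'.dual := by cases Q' <;> simp [Quant.dual]
      unfold ModeBound
      simp only [qaQ, qblQ, if_true, if_neg hdual, numAtoms]
      rw [add_comm 1]
      exact h.mono hn1 (le_max_right _ _) le_rfl
    -- For the opposite quantifier the block of the dual mode is closed: its union becomes one tame
    -- set, whose complement starts a new block at depth d + 1 with no eliminated quantifier and c =
    -- 1.
    · have hQd : Q' = Q.dual := by cases Q <;> cases Q' <;> simp_all [Quant.dual]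
      subst hQd
      have ht := h.tame_succ hn hu hc
      rw [modeSet_dual] at ht
      have ht' := ht.compl
      rw [compl_compl] at ht'
      unfold ModeBound
      simp only [qaQ, qblQ, if_neg hQ, numAtoms]
      have hk := φ.one_le_numAtoms
      refine (blockBound_zero (c := 1) (by simpa using ht')).mono hn1 (by omega) ?_
      simpa [weight] using hk

/-- The mode attaining the minimum in `qa` is used; the extra level closes the outermost block. -/
theorem tame_solutions {n b r : ℕ} (hb : 1 ≤ b) (hn : 4 ≤ n) (hnb : b * n ≤ n ^ b)
    (φ : Formula r) (hqbl : φ.qbl ≤ b) (hl : φ.length ≤ n) :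
    Tame (formBound n b (φ.qa + 1)) (sizeBound n b (φ.qa + 1)) φ.solutions := by
  have key : ∀ Q, φ.qa = φ.qaQ Q →
      Tame (formBound n b (φ.qa + 1)) (sizeBound n b (φ.qa + 1)) φ.solutions := fun Q hQ => by
    have hu := (φ.qblQ_le_qbl Q).trans hqbl
    rw [hQ]
    exact tame_solutions_of_modeSet
      (BlockBound.tame_succ hn hu (numAtoms_mul_weight_le hb hnb hu hl)
        (modeBound hb hn hnb φ hqbl hl Q))
  rcases min_choice (φ.qaQ .ex) (φ.qaQ .all) with h | h
  · exact key .ex h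
  · exact key .all h

end Formula

/-! ### From tame sets to automata -/

/-- `a` with the coordinates outside `V` replaced by zero. -/
def restrictTo {r : ℕ} (V : Finset (Fin r)) (a : Fin r → ℤ) : Fin r → ℤ :=
  fun i => if i ∈ V then a i else 0

theorem lin_restrictTo {r : ℕ} (V : Finset (Fin r)) (f a : Fin r → ℤ) :
    lin (restrictTo V f) a = lin f (restrictTo V a) := by
  simp only [lin, restrictTo]
  exact Finset.sum_congr rfl fun i _ => by split_ifs <;> simp

/-- Membership in `U` depends only on the coordinates in `V`. -/
def SupportedOn {r : ℕ} (V : Finset (Fin r)) (U : Set (Fin r → ℤ)) : Prop :=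
  ∀ a a', (∀ i ∈ V, a i = a' i) → (a ∈ U ↔ a' ∈ U)

theorem Tame.recognizable {ϱ r s l n : ℕ} (hϱ : 1 ≤ ϱ) (hn : 2 ≤ n) {U : Set (Fin r → ℤ)}
    {V : Finset (Fin r)} (hV : V.card ≤ n) (hUV : SupportedOn V U) (h : Tame s l U) :
    Recognizable ϱ ((2 * (n * 2 ^ l) + 1) ^ s * (2 ^ l) ^ n) U := by
  classical
  obtain ⟨κ, _, f, D, hcard, hD, hDl, hf, hW⟩ := h
  have : NeZero D := ⟨hD.ne'⟩
  obtain ⟨K, hK⟩ : ∃ K : ℕ, K = n * 2 ^ l := ⟨_, rfl⟩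
  have hpos : 0 < 2 ^ l := by positivity
  -- Strictness matters: clamping identifies all values from K on, whereas `SameTrunc` demands
  -- values beyond 2 ^ l. This is where n ≥ 2 enters.
  have hKl : 2 ^ l < K := by
    rw [hK]
    calc 2 ^ l < 2 * 2 ^ l := by omega
      _ ≤ n * 2 ^ l := Nat.mul_le_mul_right _ hn
  have hKl' : (2 : ℤ) ^ l < K := by exact_mod_cast hKl
  have hK0 : (0 : ℤ) < K := by omega
  have hsum : ∀ j, ∑ i, |restrictTo V (f j) i| ≤ (K : ℤ) := fun j => by
    have e : ∑ i, |restrictTo V (f j) i| = ∑ i ∈ V, |f j i| := by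
      simp only [restrictTo, apply_ite abs, abs_zero]
      rw [Finset.sum_ite_mem, Finset.univ_inter]
    rw [e]
    refine (Finset.sum_le_card_nsmul V _ _ fun i _ => hf j i).trans ?_
    rw [nsmul_eq_mul, hK]
    push_cast
    exact mul_le_mul_of_nonneg_right (by exact_mod_cast hV) (by positivity)
  refine ⟨(κ → Finset.Icc (-(K : ℤ)) K) × (V → ZMod D), inferInstance,
    fun a => (fun j => ⟨_, clamp_mem hK0.le (lin (restrictTo V (f j)) a)⟩, fun i => (a i : ZMod D)),
    ?_, ?_, ?_⟩
  · have hI : Fintype.card (Finset.Icc (-(K : ℤ)) K) = 2 * K + 1 := by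
      rw [Fintype.card_coe, Int.card_Icc]
      omega
    rw [Fintype.card_prod, Fintype.card_fun, Fintype.card_fun, ZMod.card, hI, ← hK,
      Fintype.card_coe]
    refine Nat.mul_le_mul (Nat.pow_le_pow_right (by omega) hcard) ?_
    exact (Nat.pow_le_pow_left hDl _).trans (Nat.pow_le_pow_right hpos hV)
  · intro b a a' haa
    simp only [Prod.mk.injEq, funext_iff, Subtype.mk.injEq] at haa ⊢
    refine ⟨fun j => clamp_lin_push (hsum j) hK0 hϱ b (haa.1 j), fun i => ?_⟩
    simp only [push]
    push_cast
    rw [haa.2 i]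
  · intro a a' haa
    simp only [Prod.mk.injEq, funext_iff, Subtype.mk.injEq] at haa
    have hr : ∀ a, a ∈ U ↔ restrictTo V a ∈ U := fun a =>
      hUV _ _ fun i hi => by simp [restrictTo, hi]
    rw [hr a, hr a']
    refine hW _ _ (fun i => ?_) fun j => ?_
    · unfold restrictTo
      split_ifs with hi
      · exact (ZMod.intCast_eq_intCast_iff_dvd_sub _ _ _).1 (haa.2 ⟨i, hi⟩)
      · simp
    · have := haa.1 j
      rw [clamp_eq_iff hK0, lin_restrictTo, lin_restrictTo] at this
      unfold SameTrunc
      omega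

/-- The ambient dimension r is not bounded by the length of a formula, so residues may be tracked
only for the coordinates that actually occur. -/
theorem Term.exists_support {r : ℕ} (t : Term r) : ∃ V : Finset (Fin r), V.card ≤ t.length ∧
    ∀ a a' : Fin r → ℤ, (∀ i ∈ V, a i = a' i) → t.eval a = t.eval a' := by
  induction t with
  | var i => exact ⟨{i}, by simp [length], fun a a' h => h i (by simp)⟩
  | zero => exact ⟨∅, by simp, fun _ _ _ => rfl⟩
  | one => exact ⟨∅, by simp, fun _ _ _ => rfl⟩
  | neg t ih =>
    obtain ⟨V, hV, h⟩ := ih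
    exact ⟨V, by simp only [length]; omega, fun a a' ha => by simp only [eval, h a a' ha]⟩
  | add s t ihs iht =>
    obtain ⟨V, hV, h⟩ := ihs
    obtain ⟨W, hW, h'⟩ := iht
    refine ⟨V ∪ W, ?_, fun a a' ha => ?_⟩
    · have := Finset.card_union_le V W
      simp only [length]
      omega
    · simp only [eval, h a a' fun i hi => ha i (Finset.mem_union_left _ hi),
        h' a a' fun i hi => ha i (Finset.mem_union_right _ hi)]

theorem SupportedOn.comb {r m₁ m₂ m : ℕ} {U₁ U₂ U : Set (Fin r → ℤ)}
    (h₁ : ∃ V, V.card ≤ m₁ ∧ SupportedOn V U₁) (h₂ : ∃ V, V.card ≤ m₂ ∧ SupportedOn V U₂)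
    (hm : m₁ + m₂ ≤ m)
    (hU : ∀ a a', (a ∈ U₁ ↔ a' ∈ U₁) → (a ∈ U₂ ↔ a' ∈ U₂) → (a ∈ U ↔ a' ∈ U)) :
    ∃ V, V.card ≤ m ∧ SupportedOn V U := by
  classical
  obtain ⟨V, hV, h⟩ := h₁
  obtain ⟨W, hW, h'⟩ := h₂
  refine ⟨V ∪ W, ?_, fun a a' ha => hU a a' (h a a' fun i hi => ha i (Finset.mem_union_left _ hi))
    (h' a a' fun i hi => ha i (Finset.mem_union_right _ hi))⟩
  have := Finset.card_union_le V W
  omega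

namespace Formula

theorem exists_support {r : ℕ} (φ : Formula r) :
    ∃ V : Finset (Fin r), V.card ≤ φ.length ∧ SupportedOn V φ.solutions := by
  classical
  induction φ with
  | rel R s t =>
    obtain ⟨V, hV, h⟩ := s.exists_support
    obtain ⟨W, hW, h'⟩ := t.exists_support
    refine ⟨V ∪ W, ?_, fun a a' ha => ?_⟩
    · have := Finset.card_union_le V W
      simp only [length]
      omega
    · simp only [solutions, Set.mem_ofPred_eq, Sat,
        h a a' fun i hi => ha i (Finset.mem_union_left _ hi),
        h' a a' fun i hi => ha i (Finset.mem_union_right _ hi)]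
  | dvd d hd t =>
    obtain ⟨V, hV, h⟩ := t.exists_support
    refine ⟨V, by simp only [length]; omega, fun a a' ha => ?_⟩
    simp only [solutions, Set.mem_ofPred_eq, Sat, h a a' ha]
  | not φ ih =>
    obtain ⟨V, hV, h⟩ := ih
    exact ⟨V, by simp only [length]; omega, fun a a' ha => not_congr (h a a' ha)⟩
  | and φ ψ ih₁ ih₂ =>
    exact SupportedOn.comb ih₁ ih₂ (by simp only [length]; omega) fun _ _ h h' => and_congr h h'
  | or φ ψ ih₁ ih₂ =>
    exact SupportedOn.comb ih₁ ih₂ (by simp only [length]; omega) fun _ _ h h' => or_congr h h'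
  | imp φ ψ ih₁ ih₂ =>
    exact SupportedOn.comb ih₁ ih₂ (by simp only [length]; omega) fun _ _ h h' => imp_congr h h'
  | iff φ ψ ih₁ ih₂ =>
    exact SupportedOn.comb ih₁ ih₂ (by simp only [length]; omega) fun _ _ h h' => iff_congr h h'
  | quant Q φ ih =>
    obtain ⟨V, hV, h⟩ := ih
    refine ⟨Finset.univ.filter fun i => i.castSucc ∈ V, ?_, fun a a' ha => ?_⟩
    · have := Finset.card_le_card_of_injOn (s := Finset.univ.filter fun i => i.castSucc ∈ V)
        (t := V) Fin.castSucc (fun i hi => (Finset.mem_filter.1 hi).2)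
        (Fin.castSucc_injective _).injOn
      simp only [length]
      omega
    · have key : ∀ z : ℤ, φ.Sat (Fin.snoc (α := fun _ => ℤ) a z) ↔
          φ.Sat (Fin.snoc (α := fun _ => ℤ) a' z) := fun z => by
        refine h _ _ fun i => Fin.lastCases (fun _ => by simp) (fun i hi => ?_) i
        simpa using ha i (by simpa using hi)
      cases Q
      · exact exists_congr key
      · exact forall_congr' key

/-! ### Quantifier-free formulas -/

theorem recognizable_rel {ϱ r : ℕ} (hϱ : 1 ≤ ϱ) (R : Rel) (s t : Term r) :
    Recognizable ϱ (s.length + t.length + 5) (rel R s t).solutions := by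
  have hn := norm_sub_le s t
  have h0 := Finset.sum_nonneg (s := Finset.univ) fun i _ => abs_nonneg ((s.coeff - t.coeff) i)
  have hc0 := abs_nonneg (s.const - t.const)
  -- One more than the bound from `norm_sub_le`, so that K strictly exceeds the absolute constant
  -- term.
  obtain ⟨K, hK⟩ : ∃ K : ℕ, K = (s.length + t.length + 4) / 2 := ⟨_, rfl⟩
  have hK0 : (0 : ℤ) < K := by omega
  refine ⟨Finset.Icc (-(K : ℤ)) K, inferInstance,
    fun a => ⟨_, clamp_mem hK0.le (lin (s.coeff - t.coeff) a)⟩, ?_, ?_, ?_⟩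
  · rw [Fintype.card_coe, Int.card_Icc]
    omega
  · intro b a a' h
    rw [Subtype.mk.injEq] at h ⊢
    exact clamp_lin_push (by omega) hK0 hϱ b h
  · intro a a' h
    rw [Subtype.mk.injEq, clamp_eq_iff hK0] at h
    refine R.holds_congr (eval_sub_eval s t a) (eval_sub_eval s t a') ?_
    unfold SameTrunc
    omega

theorem recognizable_dvd {ϱ r d : ℕ} (hd : 2 ≤ d) (t : Term r) :
    Recognizable ϱ d (dvd d hd t).solutions := by
  have : NeZero d := ⟨by omega⟩
  refine ⟨ZMod d, inferInstance, fun a => (t.eval a : ZMod d), (ZMod.card d).le, ?_, ?_⟩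
  · intro b a a' h
    simp only [t.eval_eq, lin_push] at h ⊢
    push_cast at h ⊢
    rw [add_right_cancel h]
  · intro a a' h
    change (d : ℤ) ∣ _ ↔ (d : ℤ) ∣ _
    rw [← ZMod.intCast_zmod_eq_zero_iff_dvd, ← ZMod.intCast_zmod_eq_zero_iff_dvd]
    simp only at h
    rw [h]

theorem mul_add_one_le_two_pow {m₁ m₂ l₁ l₂ : ℕ} (h₁ : m₁ + 1 ≤ 2 ^ l₁) (h₂ : m₂ + 1 ≤ 2 ^ l₂) :
    m₁ * m₂ + 1 ≤ 2 ^ (l₁ + 1 + l₂) := by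
  calc m₁ * m₂ + 1 ≤ (m₁ + 1) * (m₂ + 1) := by nlinarith
    _ ≤ 2 ^ l₁ * 2 ^ l₂ := Nat.mul_le_mul h₁ h₂
    _ = 2 ^ (l₁ + l₂) := (pow_add ..).symm
    _ ≤ _ := Nat.pow_le_pow_right (by norm_num) (by omega)

theorem IsQF.recognizable {ϱ r : ℕ} (hϱ : 1 ≤ ϱ) {φ : Formula r} (h : φ.IsQF) :
    ∃ m, m + 1 ≤ 2 ^ φ.length ∧ Recognizable ϱ m φ.solutions := by
  induction φ with
  | rel R s t =>
    have hs := s.one_le_length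
    have ht := t.one_le_length
    refine ⟨_, ?_, recognizable_rel hϱ R s t⟩
    -- Here k + 3 is the length of the atom; equality holds at k = 0, when both terms are single
    -- letters.
    have key : ∀ k, k + 8 ≤ 2 ^ (k + 3) := fun k => by
      induction k with
      | zero => norm_num
      | succ k ih => rw [show k + 1 + 3 = k + 3 + 1 by ring, pow_succ]; omega
    have := key (s.length + t.length - 2)
    rw [show s.length + t.length - 2 + 3 = s.length + 1 + t.length by omega] at this
    simp only [length]
    omega
  | dvd d hd t =>
    refine ⟨d, ?_, recognizable_dvd hd t⟩
    exact d.lt_two_pow_self.trans_le (Nat.pow_le_pow_right (by norm_num)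
      (by simp only [length]; omega))
  | not φ ih =>
    obtain ⟨m, hm, X, i, f, hc, ht, hs⟩ := ih h
    refine ⟨m, hm.trans (Nat.pow_le_pow_right (by norm_num) (by simp only [length]; omega)),
      X, i, f, hc, ht, fun a a' ha => not_congr (hs a a' ha)⟩
  | and φ ψ ih₁ ih₂ =>
    obtain ⟨m₁, hm₁, h₁⟩ := ih₁ h.1
    obtain ⟨m₂, hm₂, h₂⟩ := ih₂ h.2
    exact ⟨_, mul_add_one_le_two_pow hm₁ hm₂, h₁.comb h₂ fun _ _ h h' => and_congr h h'⟩
  | or φ ψ ih₁ ih₂ =>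
    obtain ⟨m₁, hm₁, h₁⟩ := ih₁ h.1
    obtain ⟨m₂, hm₂, h₂⟩ := ih₂ h.2
    exact ⟨_, mul_add_one_le_two_pow hm₁ hm₂, h₁.comb h₂ fun _ _ h h' => or_congr h h'⟩
  | imp φ ψ ih₁ ih₂ =>
    obtain ⟨m₁, hm₁, h₁⟩ := ih₁ h.1
    obtain ⟨m₂, hm₂, h₂⟩ := ih₂ h.2
    exact ⟨_, mul_add_one_le_two_pow hm₁ hm₂, h₁.comb h₂ fun _ _ h h' => imp_congr h h'⟩
  | iff φ ψ ih₁ ih₂ =>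
    obtain ⟨m₁, hm₁, h₁⟩ := ih₁ h.1
    obtain ⟨m₂, hm₂, h₂⟩ := ih₂ h.2
    exact ⟨_, mul_add_one_le_two_pow hm₁ hm₂, h₁.comb h₂ fun _ _ h h' => iff_congr h h'⟩
  | quant Q φ ih => exact h.elim

theorem isQF_of_qbl_eq_zero {r : ℕ} {φ : Formula r} (h : φ.qbl = 0) : φ.IsQF := by
  have hsub : ∀ {r r' : ℕ} {φ : Formula r} {ψ : Formula r'}, φ.subformulas ⊆ ψ.subformulas →
      ψ.qbl = 0 → φ.qbl = 0 :=
    fun hs h => Nat.le_zero.1 ((qbl_le_of_subset hs).trans h.le)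
  induction φ with
  | rel R s t => trivial
  | dvd d hd t => trivial
  | not φ ih => exact ih (hsub (by simp [subformulas]) h)
  | quant Q φ ih =>
    have := (quant Q φ).qblQ_le_qbl Q
    simp only [qblQ, if_true] at this
    omega
  | _ φ ψ ih₁ ih₂ =>
    exact ⟨ih₁ (hsub (by simp [subformulas]) h), ih₂ (hsub (by simp [subformulas]) h)⟩

theorem IsQF.qblQ_eq_zero {r : ℕ} {φ : Formula r} (h : φ.IsQF) (Q : Quant) : φ.qblQ Q = 0 := by
  induction φ generalizing Q with
  | rel R s t => rfl
  | dvd d hd t => rfl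
  | not φ ih => exact ih h _
  | quant Q φ ih => exact h.elim
  | _ φ ψ ih₁ ih₂ => simp only [qblQ, ih₁ h.1, ih₂ h.2]

theorem IsQF.qaQ_eq_zero {r : ℕ} {φ : Formula r} (h : φ.IsQF) (Q : Quant) : φ.qaQ Q = 0 := by
  induction φ generalizing Q with
  | rel R s t => rfl
  | dvd d hd t => rfl
  | not φ ih => exact ih h _
  | quant Q φ ih => exact h.elim
  | _ φ ψ ih₁ ih₂ => simp only [qaQ, ih₁ h.1, ih₂ h.2, max_self]

theorem IsQF.of_mem_subformulas {r : ℕ} {φ : Formula r} (h : φ.IsQF) :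
    ∀ ψ ∈ φ.subformulas, ψ.2.IsQF := by
  induction φ with
  | rel R s t => simp [subformulas, IsQF]
  | dvd d hd t => simp [subformulas, IsQF]
  | quant Q φ ih => exact h.elim
  | not φ ih =>
    intro ψ hψ
    rcases List.mem_cons.1 hψ with rfl | hψ
    · exact h
    · exact ih h ψ hψ
  | _ φ ψ ih₁ ih₂ =>
    intro χ hχ
    rcases List.mem_cons.1 hχ with rfl | hχ
    · exact h
    · rcases List.mem_append.1 hχ with hχ | hχ
      · exact ih₁ h.1 χ hχ
      · exact ih₂ h.2 χ hχ

theorem IsQF.qbl_eq_zero {r : ℕ} {φ : Formula r} (h : φ.IsQF) : φ.qbl = 0 :=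
  Nat.le_zero.1 (qbl_le_iff.2 fun ψ hψ Q => ((h.of_mem_subformulas ψ hψ).qblQ_eq_zero Q).le)

theorem five_le_length {r : ℕ} {φ : Formula r} (h : ¬ φ.IsQF) : 5 ≤ φ.length := by
  have h3 : ∀ {r : ℕ} (φ : Formula r), 3 ≤ φ.length := three_le_length
  induction φ with
  | rel R s t => exact absurd trivial h
  | dvd d hd t => exact absurd trivial h
  | not φ ih => exact (ih h).trans (by simp only [length]; omega)
  | quant Q φ ih =>
    have := h3 φ
    simp only [length]
    omega
  | _ φ ψ ih₁ ih₂ =>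
    have := h3 φ
    have := h3 ψ
    simp only [length]
    omega

/-! ### The bounds -/

/-- The factor n ^ (b + 1) turns the recursion into plain exponentiation to the power b + 1, whence
a closed form. -/
theorem pow_mul_formBound (n b L : ℕ) :
    n ^ (b + 1) * formBound n b L = n ^ (b + 1) ^ (L + 1) := by
  induction L with
  | zero => simp [formBound]
  | succ L ih =>
    calc n ^ (b + 1) * formBound n b (L + 1) = (n ^ (b + 1) * formBound n b L) ^ (b + 1) := by
          rw [formBound, ← mul_pow, ← mul_assoc, pow_succ n b, mul_comm (n ^ b) n]
      _ = _ := by rw [ih, ← pow_mul, ← pow_succ]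

theorem pow_mul_sizeBound (n b L : ℕ) :
    n ^ b * sizeBound n b L = n ^ ((b + 1) ^ (L + 1) + b * L) := by
  induction L with
  | zero => simp [sizeBound, pow_succ]
  | succ L ih =>
    calc n ^ b * sizeBound n b (L + 1)
        = (n ^ (b + 1) * formBound n b L) ^ b * n ^ b * (n ^ b * sizeBound n b L) := by
          rw [sizeBound, pow_succ n b]
          ring
      _ = _ := by
          rw [ih, pow_mul_formBound, ← pow_mul, ← pow_add, ← pow_add]
          congr 1
          ring

/-- With L = a + 1, forms and size contribute exponents (b + 1) ^ (a + 2) each, plus b(a + 1), which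
is no larger. The total is below 4(b + 1) ^ (a + 2), and 4 ≤ (b + 1)² since b ≥ 1. -/
theorem form_mul_size_le {n b : ℕ} (hn : 1 ≤ n) (hb : 1 ≤ b) (a : ℕ) :
    formBound n b (a + 1) * sizeBound n b (a + 1) * n ^ 2 ≤ n ^ (b + 1) ^ (a + 4) := by
  have hs : n ^ 2 * formBound n b (a + 1) ≤ n ^ (b + 1) ^ (a + 2) := by
    rw [← pow_mul_formBound]
    exact Nat.mul_le_mul_right _ (Nat.pow_le_pow_right hn (by omega))
  have hl : sizeBound n b (a + 1) ≤ n ^ ((b + 1) ^ (a + 2) + b * (a + 1)) := by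
    rw [← pow_mul_sizeBound]
    exact Nat.le_mul_of_pos_left _ (Nat.pow_pos hn)
  have hexp : b * (a + 1) ≤ (b + 1) ^ (a + 2) := by
    have h1 : a + 1 ≤ (b + 1) ^ (a + 1) := (Nat.lt_pow_self (by omega)).le
    calc b * (a + 1) ≤ (b + 1) * (b + 1) ^ (a + 1) := Nat.mul_le_mul (by omega) h1
      _ = (b + 1) ^ (a + 2) := by ring
  calc formBound n b (a + 1) * sizeBound n b (a + 1) * n ^ 2
      = (n ^ 2 * formBound n b (a + 1)) * sizeBound n b (a + 1) := by ring
    _ ≤ n ^ (b + 1) ^ (a + 2) * n ^ ((b + 1) ^ (a + 2) + b * (a + 1)) := Nat.mul_le_mul hs hl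
    _ = n ^ ((b + 1) ^ (a + 2) + ((b + 1) ^ (a + 2) + b * (a + 1))) := (pow_add ..).symm
    _ ≤ n ^ (b + 1) ^ (a + 4) := by
      refine Nat.pow_le_pow_right hn ?_
      have h4 : 4 * (b + 1) ^ (a + 2) ≤ (b + 1) ^ (a + 4) := by
        rw [show a + 4 = 2 + (a + 2) by ring, pow_add (b + 1) 2]
        exact Nat.mul_le_mul_right _ (by nlinarith)
      omega

theorem states_le {n s l : ℕ} (hn : 4 ≤ n) (hs : 1 ≤ s) (hl : n ≤ l) :
    (2 * (n * 2 ^ l) + 1) ^ s * (2 ^ l) ^ n + 1 ≤ 2 ^ (s * l * n ^ 2) := by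
  have h1 : 2 * (n * 2 ^ l) + 1 ≤ 2 ^ (n + l + 1) := by
    have h2 : 1 ≤ 2 ^ l := Nat.one_le_two_pow
    have h3 : n + 1 ≤ 2 ^ n := n.lt_two_pow_self
    calc 2 * (n * 2 ^ l) + 1 ≤ 2 * ((n + 1) * 2 ^ l) := by nlinarith
      _ ≤ 2 * (2 ^ n * 2 ^ l) := by gcongr
      _ = _ := by ring
  have hpos : 1 ≤ 2 ^ ((n + l + 1) * s + l * n) := Nat.one_le_two_pow
  calc (2 * (n * 2 ^ l) + 1) ^ s * (2 ^ l) ^ n + 1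
      ≤ (2 ^ (n + l + 1)) ^ s * (2 ^ l) ^ n + 1 := by gcongr
    _ = 2 ^ ((n + l + 1) * s + l * n) + 1 := by rw [← pow_mul, ← pow_mul, ← pow_add]
    _ ≤ 2 ^ ((n + l + 1) * s + l * n + 1) := by rw [pow_succ]; omega
    _ ≤ 2 ^ (s * l * n ^ 2) := by
      refine Nat.pow_le_pow_right (by norm_num) ?_
      have h1 : (n + l + 1) * s ≤ 3 * l * s := Nat.mul_le_mul_right s (by omega)
      have h2 : l * n ≤ s * (l * n) := Nat.le_mul_of_pos_left _ hs
      have h3 : 1 ≤ s * l := Nat.mul_pos hs (by omega)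
      have h4 : 4 * n ≤ n ^ 2 := by nlinarith
      have h5 : s * l * (n + 4) ≤ s * l * n ^ 2 := Nat.mul_le_mul_left _ (by omega)
      nlinarith

theorem exists_dfa {ϱ r : ℕ} (hϱ : 1 ≤ ϱ) (φ : Formula r) :
    ∃ (τ : Type) (_ : Fintype τ) (B : DFA (Fin r → Fin ϱ) τ),
      Fintype.card τ ≤ 2 ^ φ.length ^ (φ.qbl + 1) ^ (φ.qa + 4) ∧
        Represents B.accepts φ.solutions := by
  -- Without quantifiers the claimed bound is just 2 to the length, out of reach of the general
  -- estimate, which needs b ≥ 1.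
  by_cases hb : φ.qbl = 0
  · obtain ⟨m, hm, h⟩ := (isQF_of_qbl_eq_zero hb).recognizable hϱ
    obtain ⟨τ, i, B, hc, hB⟩ := h.exists_dfa
    exact ⟨τ, i, B, hc.trans (by simpa [hb] using hm), hB⟩
  · have hn := five_le_length fun h => hb h.qbl_eq_zero
    have hnb : φ.qbl * φ.length ≤ φ.length ^ φ.qbl := by
      obtain ⟨c, hc⟩ := Nat.exists_eq_succ_of_ne_zero hb
      rw [hc, Nat.succ_eq_add_one, pow_succ]
      exact Nat.mul_le_mul_right _ (Nat.lt_pow_self (by omega))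
    have ht := tame_solutions (by omega) (by omega) hnb φ le_rfl le_rfl
    obtain ⟨V, hV, hUV⟩ := φ.exists_support
    obtain ⟨τ, i, B, hc, hB⟩ := (ht.recognizable hϱ (by omega) hV hUV).exists_dfa
    refine ⟨τ, i, B, hc.trans ((states_le (by omega) (one_le_formBound (by omega) _ _)
      (le_sizeBound (by omega) _ _)).trans ?_), hB⟩
    exact Nat.pow_le_pow_right (by norm_num) (form_mul_size_le (by omega) (by omega) _)

/-! ### Prenex formulas and the main bounds -/

theorem IsPrenex.two_mul_qbl_add_le {r : ℕ} {φ : Formula r} (h : φ.IsPrenex) :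
    2 * φ.qbl + 3 ≤ φ.length := by
  induction h with
  | of_isQF h =>
    rw [h.qbl_eq_zero]
    exact three_le_length _
  | quant Q h ih =>
    rename_i φ
    have : (Formula.quant Q φ).qbl ≤ 1 + φ.qbl := by
      refine qbl_le_iff.2 fun ψ hψ Q' => ?_
      rcases List.mem_cons.1 hψ with rfl | hψ
      · have := φ.qblQ_le_qbl Q'
        simp only [qblQ]
        split_ifs <;> omega
      · have := qbl_le_iff.1 le_rfl ψ hψ Q'
        omega
    simp only [length]
    omega

theorem IsPrenex.two_mul_qaQ_add_le {r : ℕ} {φ : Formula r} (h : φ.IsPrenex) (Q : Quant) :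
    2 * φ.qaQ Q + 3 ≤ φ.length := by
  induction h generalizing Q with
  | of_isQF h =>
    rw [h.qaQ_eq_zero]
    exact three_le_length _
  | quant Q' h ih =>
    have h1 := ih Q
    have h2 := ih Q.dual
    simp only [length, qaQ]
    split_ifs <;> omega

theorem IsPrenex.pow_le {r : ℕ} {φ : Formula r} (h : φ.IsPrenex) :
    φ.length ^ (φ.qbl + 1) ^ (φ.qa + 4) ≤ 2 ^ 2 ^ (φ.length * Nat.clog 2 φ.length) := by
  have hb := h.two_mul_qbl_add_le
  have ha : 2 * φ.qa + 3 ≤ φ.length :=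
    (Nat.add_le_add_right (Nat.mul_le_mul_left 2 (min_le_left _ _)) 3).trans
      (h.two_mul_qaQ_add_le .ex)
  generalize φ.length = n at *
  generalize φ.qbl = b at *
  generalize φ.qa = a at *
  have hn2 : n ≤ 2 ^ Nat.clog 2 n := Nat.le_pow_clog (by norm_num) n
  have hc1 : 1 ≤ Nat.clog 2 n := Nat.clog_pos (by norm_num) (by omega)
  have hcn : Nat.clog 2 n ≤ n := Nat.clog_le_of_le_pow n.lt_two_pow_self.le
  generalize Nat.clog 2 n = c at *
  obtain ⟨c, rfl⟩ : ∃ c', c = c' + 1 := ⟨c - 1, by omega⟩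
  have hexp : (b + 1) ^ (a + 4) ≤ 2 ^ (n * c) := by
    rcases Nat.eq_zero_or_pos b with rfl | hb0
    · simpa using Nat.one_le_two_pow
    -- Each quantifier costs two letters, so b + 1 is below n / 2; this saves one from the
    -- logarithm. The saved factor 2 ^ n later absorbs the exponent c + 1.
    · have h1 : b + 1 ≤ 2 ^ c := by
        rw [pow_succ] at hn2
        omega
      calc (b + 1) ^ (a + 4) ≤ (b + 1) ^ n := Nat.pow_le_pow_right (by omega) (by omega)
        _ ≤ (2 ^ c) ^ n := Nat.pow_le_pow_left h1 n
        _ = _ := by rw [← pow_mul, mul_comm]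
  calc n ^ (b + 1) ^ (a + 4) ≤ (2 ^ (c + 1)) ^ (b + 1) ^ (a + 4) := Nat.pow_le_pow_left hn2 _
    _ = 2 ^ ((c + 1) * (b + 1) ^ (a + 4)) := (pow_mul ..).symm
    _ ≤ 2 ^ 2 ^ (n * (c + 1)) := by
      refine Nat.pow_le_pow_right (by norm_num) ?_
      calc (c + 1) * (b + 1) ^ (a + 4) ≤ 2 ^ n * 2 ^ (n * c) :=
            Nat.mul_le_mul (hcn.trans n.lt_two_pow_self.le) hexp
        _ = 2 ^ (n * (c + 1)) := by rw [← pow_add]; congr 1; ring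

end Formula

end PA

theorem mainTheorem1 (ϱ : ℕ) (hϱ : 2 ≤ ϱ) (r : ℕ) (φ : PA.Formula r) :
    (∃ (m : ℕ) (A : DFA (Fin r → Fin ϱ) (Fin m)),
      PA.Represents A.accepts φ.solutions ∧ PA.IsMinimal A) ∧
    ∀ (σ : Type) [Fintype σ] (A : DFA (Fin r → Fin ϱ) σ),
      PA.Represents A.accepts φ.solutions → PA.IsMinimal A →
        Fintype.card σ ≤ 2 ^ φ.length ^ (φ.qbl + 1) ^ (φ.qa + 4) ∧
        (φ.IsPrenex → Fintype.card σ ≤ 2 ^ 2 ^ 2 ^ (φ.length * Nat.clog 2 φ.length)) := by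
  obtain ⟨τ, _, B, hc, hB⟩ := φ.exists_dfa (ϱ := ϱ) (by omega)
  constructor
  · obtain ⟨m, A, hA, hmin⟩ := PA.exists_isMinimal B
    exact ⟨m, A, hA ▸ hB, hmin⟩
  · intro σ _ A hA hmin
    have h := (hmin.card_le B (hB.accepts_eq hA)).trans hc
    exact ⟨h, fun hp => h.trans (Nat.pow_le_pow_right (by norm_num) hp.pow_le)⟩
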